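/- Let $\mathcal A=\{a_i : i\ge 1\}$ be a countably infinite alphabet, let $0<\delta<\tfrac12$, and let $(p_i)_{i\ge1}$ be a probability distribution on $\mathcal A$ (some $p_i$ may be $0$) that is nonuniform, meaning that $p_i\ne p_j$ for some $i,j$ with $p_i,p_j>0$. Write $p(a_i)=p_i$ and $0\ln 0=0$. Let $X_1,X_2,\dots$ be i.i.d. random variables in $\mathcal A$ with $\mathbb P(X_1=a_i)=p_i$ for all $i$, and assume $\mathbb E|\ln p(X_1)|^{2+\delta}<\infty$. Assume that there are an integer-valued function $K(n)$ and a constant $C_0$ such that, for all $n\ge1$, $$K(n)\le n^{\frac12-\delta},\qquad n^{\frac12+\delta}\ln n\sum_{i\ge K(n)}p_i\le C_0,\qquad -n^{\frac12+\delta}\sum_{i\ge K(n)}p_i\ln p_i\le C_0,$$ where the sums run over indices $i\ge1$. Let $$H=-\sum_{i\ge1}p_i\ln p_i,\qquad \hat p_i=\frac1n\sum_{k=1}^n I_{\{X_k=a_i\}},\qquad \hat H_n=-\sum_{i\ge1}\hat p_i\ln\hat p_i,\qquad \sigma^2=\operatorname{Var}(\ln p(X_1)),\quad \sigma\ge 0.$$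 Then there is a constant $C$, depending only on $\delta$, $(p_i)_{i\ge1}$ and $C_0$, such that for all $n\ge1$ $$\sup_{x\in\mathbb R}\left|\mathbb P\left(\frac{\sqrt n\,(\hat H_n-H)}{\sigma}<x\right)-\Phi(x)\right|\le C\,n^{-\delta/2},$$ where $\Phi$ is the standard normal distribution function. -/

import Mathlib

open MeasureTheory ProbabilityTheory

noncomputable section

namespace DiversityIndex

/-- Shannon entropy (natural logarithm) of a family of letter probabilities `q` on a countable
alphabet `A`, with the usual convention `0 ln 0 = 0`. -/
def shannonEntropy {A : Type*} (q : A → ℝ) : ℝ :=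
  -∑' x, q x * Real.log (q x)

/-- The sample proportion of the letter `x` among the first `n` observations
`X 0, …, X (n - 1)`. -/
def sampleProportion {Ω A : Type*} (X : ℕ → Ω → A) (n : ℕ) (ω : Ω) (x : A) : ℝ :=
  (1 / (n : ℝ)) * ∑ k ∈ Finset.range n, Set.indicator {ω' | X k ω' = x} (fun _ => (1 : ℝ)) ω

/-- The plug-in estimator of Shannon's entropy based on the first `n` observations. -/
def plugInEntropy {Ω A : Type*} (X : ℕ → Ω → A) (n : ℕ) (ω : Ω) : ℝ :=
  shannonEntropy (sampleProportion X n ω)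

/-- A family of letter probabilities is nonuniform if it is not uniform on its support: two letters
of positive probability have different probabilities. -/
def IsNonuniform {A : Type*} (p : A → ℝ) : Prop :=
  ∃ x y, 0 < p x ∧ 0 < p y ∧ p x ≠ p y

/-- The conditions on the cut-off `K n` with bounding constant `C₀`, for letters enumerated
as `a 1, a 2, …`. A cut-off `K n ≤ 1` means that the sums run over all letters. -/
structure IsTailCutoff {A : Type*} (a : ℕ+ ≃ A) (p : A → ℝ) (δ C₀ : ℝ) (K : ℕ → ℤ) : Prop where
  le_rpow : ∀ n : ℕ, 1 ≤ n → (K n : ℝ) ≤ (n : ℝ) ^ (1 / 2 - δ)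
  tail_prob : ∀ n : ℕ, 1 ≤ n →
    (n : ℝ) ^ (1 / 2 + δ) * Real.log n *
      ∑' i : {i : ℕ+ // K n ≤ ((i : ℕ) : ℤ)}, p (a i) ≤ C₀
  tail_entropy : ∀ n : ℕ, 1 ≤ n →
    -((n : ℝ) ^ (1 / 2 + δ)) *
      ∑' i : {i : ℕ+ // K n ≤ ((i : ℕ) : ℤ)}, p (a i) * Real.log (p (a i)) ≤ C₀

end DiversityIndex

end

open scoped NNReal

namespace DiversityIndex

/-! The empirical mean of `-log p (X k)` exceeds the plug-in entropy by exactly the relative entropy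
`D` of the sample proportions with respect to `p` (`mean_sub_plugInEntropy_eq`). Hence the
normalised estimator equals `T - R`, where `T` is a standardised i.i.d. sum and `R = √n D / σ` is
almost surely nonnegative.

For `T`, a Berry–Esseen theorem under a moment of order `2 + δ` gives the rate `n ^ (-δ/2)`
(`exists_abs_cdf_sub_cdf_gaussianReal_le`). It is proved by Fourier methods: smooth both laws by a
centred Gaussian, compare the smoothed distribution functions through characteristic functions, then
remove the smoothing at the cost of its width.

For `R`, split the relative entropy at the cut-off. A head letter contributes a chi-square term of
mean at most `1 / n`, whatever its probability; the tail contributes at most the tail entropy of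
`p`. So the mean of `D` is at most `(1 + C₀) n ^ (-(1/2 + δ))`, and by Markov `R` exceeds `ε = n ^
(-δ/2)` with probability at most `(1 + C₀) ε / σ`. Shifting the argument of the normal distribution
function by `ε` costs at most `ε`. -/

/-! ### Gaussian smoothing and Fourier inversion. -/

/-- Gaussians are self-dual under the Fourier transform. Integrating against the probability measure
of variance `v⁻¹` keeps every later use of Fubini within finite measures. -/
lemma gaussianPDFReal_eq_integral_exp (v : ℝ≥0) (w : ℝ) :
    (gaussianPDFReal 0 v w : ℂ) =
      (√(2 * Real.pi * v))⁻¹ * ∫ t, Complex.exp (t * w * Complex.I) ∂gaussianReal 0 v⁻¹ := by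
  have h := charFun_gaussianReal (μ := 0) (v := v⁻¹) w
  rw [charFun_apply_real] at h
  have h2 : ∫ t, Complex.exp (t * w * Complex.I) ∂gaussianReal 0 v⁻¹ =
      Complex.exp (w * (0 : ℝ) * Complex.I - (v⁻¹ : ℝ≥0) * w ^ 2 / 2) := by
    rw [← h]
    congr 1
    ext t
    ring_nf
  rw [h2, gaussianPDFReal]
  push_cast
  congr 2
  simp only [sub_zero]
  ring_nf

/-- The Fourier transform of the indicator of an interval. -/
lemma norm_mul_integral_exp_le (y x t : ℝ) (hyx : y ≤ x) :
    |t| * ‖∫ u in Set.Ioc y x, Complex.exp (-(t * u * Complex.I))‖ ≤ 2 := by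
  rcases eq_or_ne t 0 with rfl | ht
  · simp
  have hc : (-(t * Complex.I) : ℂ) ≠ 0 := by simpa using ht
  have h := integral_exp_mul_complex (a := y) (b := x) hc
  rw [intervalIntegral.integral_of_le hyx] at h
  have h2 : ∫ u in Set.Ioc y x, Complex.exp (-(t * u * Complex.I)) =
      ∫ u in Set.Ioc y x, Complex.exp (-(t * Complex.I) * u) := by
    congr 1
    ext u
    ring_nf
  rw [h2, h, norm_div]
  have h3 : ‖(-(t * Complex.I) : ℂ)‖ = |t| := by simp
  rw [h3, mul_div_cancel₀ _ (abs_ne_zero.mpr ht)]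
  refine (norm_sub_le _ _).trans ?_
  have h4 : ∀ z : ℝ, ‖Complex.exp (-(t * Complex.I) * z)‖ = 1 := by
    intro z
    rw [show (-(t * Complex.I) * z : ℂ) = ((-(t * z) : ℝ) : ℂ) * Complex.I by push_cast; ring]
    exact Complex.norm_exp_ofReal_mul_I _
  rw [h4, h4]
  norm_num

/-- Inversion formula for the smoothed mass of `(y, x]`: write it as a double integral of the
Gaussian density, insert the Fourier integral of that density, and swap. All integrands are bounded
on finite measures, so `charFun μ` need not be integrable. -/
lemma integral_cdf_sub_gaussian_eq {v : ℝ≥0} (hv : v ≠ 0) (μ : Measure ℝ)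
    [IsProbabilityMeasure μ] (y x : ℝ) (hyx : y ≤ x) :
    ((∫ z, (cdf μ (x - z) - cdf μ (y - z)) ∂gaussianReal 0 v : ℝ) : ℂ) =
      (√(2 * Real.pi * v))⁻¹ * ∫ t, charFun μ t *
        (∫ u in Set.Ioc y x, Complex.exp (-(t * u * Complex.I))) ∂gaussianReal 0 v⁻¹ := by
  set γ := gaussianReal 0 v
  set γ' := gaussianReal 0 v⁻¹
  let ind : ℝ → ℝ := Set.indicator (Set.Ioc y x) 1
  have hind : Measurable ind := measurable_one.indicator measurableSet_Ioc
  have h1 : ∀ z, cdf μ (x - z) - cdf μ (y - z) = ∫ s, ind (s + z) ∂μ := by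
    intro z
    rw [cdf_eq_real, cdf_eq_real]
    have e : (fun s => ind (s + z)) = Set.indicator (Set.Ioc (y - z) (x - z)) 1 := by
      ext s
      simp only [ind, Set.indicator, Set.mem_Ioc, sub_lt_iff_lt_add, le_sub_iff_add_le,
        Pi.one_apply]
    rw [e, integral_indicator_one measurableSet_Ioc,
      ← measureReal_sdiff (Set.Iic_subset_Iic.mpr (by linarith)) measurableSet_Iic]
    congr 1
    ext s
    simp [and_comm]
  have h2 : ∀ s, ∫ z, ind (s + z) ∂γ = ∫ u in Set.Ioc y x, gaussianPDFReal 0 v (s - u) := by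
    intro s
    rw [integral_gaussianReal_eq_integral_smul hv, ← integral_indicator measurableSet_Ioc,
      ← integral_add_left_eq_self ((Set.Ioc y x).indicator _) s]
    congr 1
    ext z
    have : gaussianPDFReal 0 v (s - (s + z)) = gaussianPDFReal 0 v z := by
      simp [gaussianPDFReal]
    by_cases h : s + z ∈ Set.Ioc y x
    · simp only [ind, Set.indicator_of_mem h, this, Pi.one_apply, smul_eq_mul, mul_one]
    · simp only [ind, Set.indicator_of_notMem h, smul_eq_mul, mul_zero]
  have h3 : ∫ z, (cdf μ (x - z) - cdf μ (y - z)) ∂γ =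
      ∫ s, ∫ u in Set.Ioc y x, gaussianPDFReal 0 v (s - u) ∂volume ∂μ := by
    simp_rw [h1, ← h2]
    refine integral_integral_swap ?_
    refine Integrable.of_bound (C := 1)
      (hind.comp (by fun_prop : Measurable fun q : ℝ × ℝ => q.2 + q.1)).aestronglyMeasurable
      (.of_forall fun q => ?_)
    simp only [Function.uncurry, ind, Set.indicator]
    split_ifs <;> simp
  have hexp : ∀ s u t : ℝ, Complex.exp (t * (s - u : ℝ) * Complex.I) =
      Complex.exp (s * t * Complex.I) * Complex.exp (-(t * u * Complex.I)) := by
    intro s u t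
    rw [← Complex.exp_add]
    push_cast
    ring_nf
  have hn : ∀ a b : ℝ, ‖Complex.exp (a * b * Complex.I)‖ = 1 := fun a b => by
    exact_mod_cast Complex.norm_exp_ofReal_mul_I (a * b)
  have hn' : ∀ a b : ℝ, ‖Complex.exp (-(a * b * Complex.I))‖ = 1 := fun a b => by
    rw [← hn (-a) b]
    push_cast
    ring_nf
  have h4 : ∀ s : ℝ, ((∫ u in Set.Ioc y x, gaussianPDFReal 0 v (s - u) : ℝ) : ℂ) =
      (√(2 * Real.pi * v))⁻¹ * ∫ t, Complex.exp (s * t * Complex.I) *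
        (∫ u in Set.Ioc y x, Complex.exp (-(t * u * Complex.I))) ∂γ' := by
    intro s
    rw [← integral_complex_ofReal]
    simp_rw [gaussianPDFReal_eq_integral_exp v]
    rw [integral_const_mul]
    congr 1
    rw [integral_integral_swap]
    · congr 1
      ext t
      rw [← integral_const_mul]
      simp_rw [hexp]
    · refine Integrable.of_bound (C := 1) (by fun_prop) (.of_forall fun q => ?_)
      simp only [Function.uncurry]
      rw [hn]
  rw [h3, ← integral_complex_ofReal]
  simp_rw [h4]
  rw [integral_const_mul]
  congr 1
  rw [integral_integral_swap]
  · congr 1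
    ext t
    rw [integral_mul_const, charFun_apply_real]
    congr 2
    ext s
    ring_nf
  · refine Integrable.of_bound (C := x - y) ?_ (.of_forall fun q => ?_)
    · refine AEStronglyMeasurable.mul (by fun_prop) ?_
      have hm : StronglyMeasurable (fun t : ℝ =>
          ∫ u in Set.Ioc y x, Complex.exp (-(t * u * Complex.I))) := by
        refine StronglyMeasurable.integral_prod_right (f := fun t u : ℝ => _) ?_
        exact Continuous.stronglyMeasurable (by fun_prop)
      exact (hm.comp_measurable measurable_snd).aestronglyMeasurable
    · simp only [Function.uncurry]
      rw [norm_mul, hn, one_mul]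
      refine (norm_setIntegral_le_of_norm_le_const (C := 1) (by simp) (fun u _ => (hn' _ _).le)).trans ?_
      simp [hyx]

/-- The Gaussian-smoothed distance of two distribution functions is controlled by the distance of
the characteristic functions. -/
lemma abs_integral_cdf_sub_cdf_gaussian_le {v : ℝ≥0} (hv : v ≠ 0) (μ₁ μ₂ : Measure ℝ)
    [IsProbabilityMeasure μ₁] [IsProbabilityMeasure μ₂] (g : ℝ → ℝ)
    (hg : Integrable g (gaussianReal 0 v⁻¹)) (hg0 : ∀ t, 0 ≤ g t)
    (h : ∀ t, ‖charFun μ₁ t - charFun μ₂ t‖ ≤ |t| * g t) (x : ℝ) :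
    |∫ z, (cdf μ₁ (x - z) - cdf μ₂ (x - z)) ∂gaussianReal 0 v| ≤
      2 * (√(2 * Real.pi * v))⁻¹ * ∫ t, g t ∂gaussianReal 0 v⁻¹ := by
  have hmeas : ∀ (μ : Measure ℝ) (w : ℝ), Measurable (fun z => cdf μ (w - z)) := fun μ w =>
    (monotone_cdf μ).measurable.comp (measurable_const.sub measurable_id)
  have hint : ∀ (μ : Measure ℝ) (w : ℝ),
      Integrable (fun z => cdf μ (w - z)) (gaussianReal 0 v) := fun μ w => by
    refine Integrable.of_bound (C := 1) (hmeas μ w).aestronglyMeasurable (.of_forall fun z => ?_)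
    rw [Real.norm_eq_abs, abs_of_nonneg (cdf_nonneg _ _)]
    exact cdf_le_one _ _
  set S : ℝ → ℝ := fun w => ∫ z, (cdf μ₁ (w - z) - cdf μ₂ (w - z)) ∂gaussianReal 0 v
  have key : ∀ y ≤ x, |S x - S y| ≤
      2 * (√(2 * Real.pi * v))⁻¹ * ∫ t, g t ∂gaussianReal 0 v⁻¹ := by
    intro y hyx
    have e : S x - S y = (∫ z, (cdf μ₁ (x - z) - cdf μ₁ (y - z)) ∂gaussianReal 0 v) -
        ∫ z, (cdf μ₂ (x - z) - cdf μ₂ (y - z)) ∂gaussianReal 0 v := by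
      simp only [S]
      rw [integral_sub (hint _ _) (hint _ _), integral_sub (hint _ _) (hint _ _),
        integral_sub (hint _ _) (hint _ _), integral_sub (hint _ _) (hint _ _)]
      ring
    rw [← Real.norm_eq_abs, ← Complex.norm_real, e, Complex.ofReal_sub, integral_cdf_sub_gaussian_eq hv μ₁ y x hyx,
      integral_cdf_sub_gaussian_eq hv μ₂ y x hyx, ← mul_sub]
    have hm : StronglyMeasurable (fun t : ℝ =>
        ∫ u in Set.Ioc y x, Complex.exp (-(t * u * Complex.I))) := by
      refine StronglyMeasurable.integral_prod_right (f := fun t u : ℝ => _) ?_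
      exact Continuous.stronglyMeasurable (by fun_prop)
    have hn' : ∀ a b : ℝ, ‖Complex.exp (-(a * b * Complex.I))‖ = 1 := fun a b => by
      rw [show (-(a * b * Complex.I) : ℂ) = ((-(a * b) : ℝ) : ℂ) * Complex.I by push_cast; ring]
      exact Complex.norm_exp_ofReal_mul_I _
    have hi : ∀ (μ : Measure ℝ) [IsProbabilityMeasure μ], Integrable (fun t : ℝ => charFun μ t *
        (∫ u in Set.Ioc y x, Complex.exp (-(t * u * Complex.I)))) (gaussianReal 0 v⁻¹) := by
      intro μ _
      refine Integrable.of_bound (C := 1 * (x - y))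
        (stronglyMeasurable_charFun.mul hm).aestronglyMeasurable (.of_forall fun q => ?_)
      rw [norm_mul]
      refine mul_le_mul (norm_charFun_le_one _) ?_ (norm_nonneg _) zero_le_one
      refine (norm_setIntegral_le_of_norm_le_const (C := 1) (by simp)
        (fun u _ => (hn' _ _).le)).trans ?_
      simp [hyx]
    rw [← integral_sub (hi _) (hi _), norm_mul]
    have hc : ‖((√(2 * Real.pi * v))⁻¹ : ℂ)‖ = (√(2 * Real.pi * v))⁻¹ := by
      rw [norm_inv, Complex.norm_real, Real.norm_eq_abs, abs_of_nonneg (Real.sqrt_nonneg _)]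
    rw [Complex.ofReal_inv, hc]
    rw [show 2 * (√(2 * Real.pi * v))⁻¹ * ∫ t, g t ∂gaussianReal 0 v⁻¹ =
      (√(2 * Real.pi * v))⁻¹ * (2 * ∫ t, g t ∂gaussianReal 0 v⁻¹) by ring]
    refine mul_le_mul_of_nonneg_left ?_ (inv_nonneg.mpr (Real.sqrt_nonneg _))
    rw [← integral_const_mul]
    refine norm_integral_le_of_norm_le (hg.const_mul 2) (.of_forall fun t => ?_)
    rw [← sub_mul, norm_mul]
    have h0 := norm_mul_integral_exp_le y x t hyx
    calc _ ≤ (|t| * g t) * ‖∫ u in Set.Ioc y x, Complex.exp (-(t * u * Complex.I))‖ :=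
          mul_le_mul_of_nonneg_right (h t) (norm_nonneg _)
      _ = g t * (|t| * ‖∫ u in Set.Ioc y x, Complex.exp (-(t * u * Complex.I))‖) := by ring
      _ ≤ g t * 2 := mul_le_mul_of_nonneg_left h0 (hg0 t)
      _ = 2 * g t := by ring
  -- The bound `key` on increments is uniform in `y`, so letting `y` tend to `-∞` turns it into a
  -- bound on `S x` itself.
  have hlim : Filter.Tendsto S Filter.atBot (nhds 0) := by
    have : Filter.Tendsto S Filter.atBot (nhds (∫ z, (0 : ℝ) ∂gaussianReal 0 v)) := by
      refine tendsto_integral_filter_of_dominated_convergence (fun _ => 2)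
        (.of_forall fun w => ((hmeas _ _).sub (hmeas _ _)).aestronglyMeasurable)
        (.of_forall fun w => .of_forall fun z => ?_) (integrable_const _) (.of_forall fun z => ?_)
      · rw [Real.norm_eq_abs, abs_le]
        have a1 := cdf_nonneg μ₁ (w - z)
        have a2 := cdf_nonneg μ₂ (w - z)
        have a3 := cdf_le_one μ₁ (w - z)
        have a4 := cdf_le_one μ₂ (w - z)
        constructor <;> linarith
      · have ht : Filter.Tendsto (fun w : ℝ => w - z) Filter.atBot Filter.atBot :=
          Filter.tendsto_atBot_add_const_right _ _ Filter.tendsto_id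
        simpa using ((tendsto_cdf_atBot μ₁).comp ht).sub ((tendsto_cdf_atBot μ₂).comp ht)
    simpa using this
  have hlim2 : Filter.Tendsto (fun y => |S x - S y|) Filter.atBot (nhds |S x - 0|) :=
    (tendsto_const_nhds.sub hlim).abs
  rw [sub_zero] at hlim2
  exact le_of_tendsto hlim2 ((Filter.eventually_le_atBot x).mono key)

lemma gaussianReal_le_smul_volume {v : ℝ≥0} (hv : v ≠ 0) (m : ℝ) :
    gaussianReal m v ≤ ENNReal.ofReal (√(2 * Real.pi * v))⁻¹ • (volume : Measure ℝ) := by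
  rw [gaussianReal_of_var_ne_zero m hv, ← withDensity_const]
  refine withDensity_mono (.of_forall fun x => ?_)
  refine ENNReal.ofReal_le_ofReal ?_
  rw [gaussianPDFReal]
  refine mul_le_of_le_one_right (by positivity) (Real.exp_le_one_iff.mpr ?_)
  exact div_nonpos_of_nonpos_of_nonneg (neg_nonpos.mpr (sq_nonneg _)) (by positivity)

lemma cdf_gaussianReal_sub_le {a b : ℝ} (hab : a ≤ b) :
    cdf (gaussianReal 0 1) b - cdf (gaussianReal 0 1) a ≤ b - a := by
  rw [cdf_eq_real, cdf_eq_real,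
    ← measureReal_sdiff (Set.Iic_subset_Iic.mpr hab) measurableSet_Iic]
  have e : Set.Iic b \ Set.Iic a = Set.Ioc a b := by
    ext s
    simp [and_comm]
  have h := gaussianReal_le_smul_volume one_ne_zero 0 (Set.Ioc a b)
  have hc : (√(2 * Real.pi * (1 : ℝ≥0)))⁻¹ ≤ 1 := by
    refine inv_le_one_of_one_le₀ (Real.one_le_sqrt.mpr ?_)
    have := Real.pi_gt_three
    simp only [NNReal.coe_one]
    linarith
  rw [e, measureReal_def]
  refine ENNReal.toReal_le_of_le_ofReal (by linarith) (h.trans ?_)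
  rw [Measure.smul_apply, Real.volume_Ioc, smul_eq_mul]
  refine mul_le_of_le_one_left zero_le ?_
  exact_mod_cast ENNReal.ofReal_le_ofReal hc

/-- Removal of the smoothing. Let `Δ` be the supremum of `|D|`. For `|z| < a`, monotonicity of one
distribution function and the Lipschitz bound on the other prevent `D (x + a - z)` from falling more
than `2 * a` below `D x`; elsewhere the loss is at most `2 * Δ`. Averaging gives `Δ ≤ B + 2 * a + Δ
/ 2`. -/
lemma abs_cdf_sub_cdf_le_of_smoothed {v : ℝ≥0} (hv : v ≠ 0) (μ₁ μ₂ : Measure ℝ)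
    [IsProbabilityMeasure μ₁] [IsProbabilityMeasure μ₂]
    (hlip : ∀ a b, a ≤ b → cdf μ₂ b - cdf μ₂ a ≤ b - a) (B : ℝ)
    (hB : ∀ x, |∫ z, (cdf μ₁ (x - z) - cdf μ₂ (x - z)) ∂gaussianReal 0 v| ≤ B) (x : ℝ) :
    |cdf μ₁ x - cdf μ₂ x| ≤ 2 * B + 8 * √v := by
  set D : ℝ → ℝ := fun x => cdf μ₁ x - cdf μ₂ x with hD
  have hDm : Measurable D := (monotone_cdf μ₁).measurable.sub (monotone_cdf μ₂).measurable
  have hD1 : ∀ x, |D x| ≤ 1 := fun x => by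
    have a1 := cdf_nonneg μ₁ x
    have a2 := cdf_nonneg μ₂ x
    have a3 := cdf_le_one μ₁ x
    have a4 := cdf_le_one μ₂ x
    rw [abs_le]
    constructor <;> simp only [hD] <;> linarith
  have hbdd : BddAbove (Set.range fun x => |D x|) := ⟨1, by rintro _ ⟨x, rfl⟩; exact hD1 x⟩
  set Δ := ⨆ x, |D x|
  have hΔ : ∀ x, |D x| ≤ Δ := fun x => le_ciSup hbdd x
  have hΔ0 : 0 ≤ Δ := (abs_nonneg _).trans (hΔ 0)
  -- Two standard deviations: Chebyshev leaves mass at most `1 / 4` outside, so the loss `2 * Δ / 4`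
  -- can be absorbed.
  set a : ℝ := 2 * √v
  have hv0 : (0 : ℝ) < v := by exact_mod_cast pos_iff_ne_zero.mpr hv
  have ha : 0 < a := by positivity
  set T : Set ℝ := {z | a ≤ |z|}
  have hT : MeasurableSet T := measurableSet_le measurable_const measurable_id.abs
  have hcheb : (gaussianReal 0 v).real T ≤ 1 / 4 := by
    have h := meas_ge_le_variance_div_sq (memLp_id_gaussianReal (μ := 0) (v := v) 2) ha
    simp only [id, integral_id_gaussianReal, sub_zero] at h
    have h2 : Var[id; gaussianReal 0 v] = v := variance_id_gaussianReal
    rw [h2] at h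
    refine ENNReal.toReal_le_of_le_ofReal (by norm_num) (h.trans (ENNReal.ofReal_le_ofReal ?_))
    simp only [a]
    rw [mul_pow, Real.sq_sqrt hv0.le, div_le_div_iff₀ (by positivity) (by norm_num)]
    linarith
  have hint : ∀ w, Integrable (fun z => D (w - z)) (gaussianReal 0 v) := fun w =>
    Integrable.of_bound (C := 1)
      (hDm.comp (measurable_const.sub measurable_id)).aestronglyMeasurable (.of_forall fun z => hD1 _)
  have hintT : Integrable (T.indicator (1 : ℝ → ℝ)) (gaussianReal 0 v) :=
    (integrable_const (1 : ℝ)).indicator hT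
  have hTi : ∫ z, T.indicator (1 : ℝ → ℝ) z ∂gaussianReal 0 v ≤ 1 / 4 := by
    rwa [integral_indicator_one hT]
  have upper : ∀ x, D x ≤ B + 2 * a + Δ / 2 := by
    intro x
    have hpt : ∀ z, D x - 2 * a - 2 * Δ * T.indicator (1 : ℝ → ℝ) z ≤ D (x + a - z) := by
      intro z
      by_cases hz : z ∈ T
      · simp only [Set.indicator_of_mem hz, Pi.one_apply]
        have h1 := abs_le.mp (hΔ x)
        have h2 := abs_le.mp (hΔ (x + a - z))
        linarith [h1.2, h2.1]
      · simp only [Set.indicator_of_notMem hz]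
        have hz' : |z| < a := not_le.mp hz
        rw [abs_lt] at hz'
        have h1 := monotone_cdf μ₁ (show x ≤ x + a - z by linarith)
        have h2 := hlip x (x + a - z) (by linarith)
        simp only [hD]
        linarith
    have h := integral_mono (((integrable_const (D x - 2 * a)).sub (hintT.const_mul (2 * Δ))))
      (hint (x + a)) hpt
    simp only [Pi.sub_apply] at h
    rw [integral_sub (integrable_const _) (hintT.const_mul _), integral_const_mul] at h
    simp only [integral_const, probReal_univ, one_smul] at h
    have h2 := (abs_le.mp (hB (x + a))).2
    have h3 : 2 * Δ * ∫ z, T.indicator (1 : ℝ → ℝ) z ∂gaussianReal 0 v ≤ 2 * Δ * (1 / 4) :=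
      mul_le_mul_of_nonneg_left hTi (by positivity)
    simp only [hD] at h h2 ⊢
    linarith
  have lower : ∀ x, -D x ≤ B + 2 * a + Δ / 2 := by
    intro x
    have hpt : ∀ z, D (x - a - z) ≤ D x + 2 * a + 2 * Δ * T.indicator (1 : ℝ → ℝ) z := by
      intro z
      by_cases hz : z ∈ T
      · simp only [Set.indicator_of_mem hz, Pi.one_apply]
        have h1 := abs_le.mp (hΔ x)
        have h2 := abs_le.mp (hΔ (x - a - z))
        linarith [h1.1, h2.2]
      · simp only [Set.indicator_of_notMem hz]
        have hz' : |z| < a := not_le.mp hz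
        rw [abs_lt] at hz'
        have h1 := monotone_cdf μ₁ (show x - a - z ≤ x by linarith)
        have h2 := hlip (x - a - z) x (by linarith)
        simp only [hD]
        linarith
    have h := integral_mono (hint (x - a))
      (((integrable_const (D x + 2 * a)).add (hintT.const_mul (2 * Δ)))) hpt
    simp only [Pi.add_apply] at h
    rw [integral_add (integrable_const _) (hintT.const_mul _), integral_const_mul] at h
    simp only [integral_const, probReal_univ, one_smul] at h
    have h2 := (abs_le.mp (hB (x - a))).1
    have h3 : 2 * Δ * ∫ z, T.indicator (1 : ℝ → ℝ) z ∂gaussianReal 0 v ≤ 2 * Δ * (1 / 4) :=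
      mul_le_mul_of_nonneg_left hTi (by positivity)
    simp only [hD] at h h2 ⊢
    linarith
  have hle : Δ ≤ B + 2 * a + Δ / 2 := ciSup_le fun x => abs_le'.mpr ⟨upper x, lower x⟩
  have := hΔ x
  simp only [hD, a] at *
  linarith

/-! ### Characteristic functions under a moment of order `2 + δ`. -/

/-- The Taylor remainder is cubic for `|u| ≤ 1` and quadratic beyond; the power `2 + δ` dominates
both. -/
lemma norm_exp_mul_I_sub_le {δ : ℝ} (hδ₀ : 0 ≤ δ) (hδ₁ : δ ≤ 1) (u : ℝ) :
    ‖Complex.exp (u * Complex.I) - (1 + u * Complex.I - u ^ 2 / 2)‖ ≤ 4 * |u| ^ (2 + δ) := by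
  rcases le_or_gt |u| 1 with hu | hu
  · have hx : ‖(u * Complex.I : ℂ)‖ = |u| := by simp
    have h := Complex.exp_bound (x := u * Complex.I) (by rwa [hx]) (n := 3) (by norm_num)
    rw [hx] at h
    have e : ∑ m ∈ Finset.range 3, (u * Complex.I : ℂ) ^ m / (m.factorial : ℂ) =
        1 + u * Complex.I - u ^ 2 / 2 := by
      simp [Finset.sum_range_succ, Nat.factorial, mul_pow]
      ring
    rw [e] at h
    refine h.trans ?_
    have h3 : |u| ^ 3 ≤ |u| ^ (2 + δ) := by
      rcases (abs_nonneg u).eq_or_lt with h0 | h0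
      · rw [← h0]
        have : (0 : ℝ) ^ 3 = 0 := by norm_num
        rw [this]
        positivity
      · rw [← Real.rpow_natCast]
        exact Real.rpow_le_rpow_of_exponent_ge h0 hu (by push_cast; linarith)
    calc |u| ^ 3 * _ ≤ |u| ^ 3 * 4 := by
          refine mul_le_mul_of_nonneg_left ?_ (by positivity)
          norm_num [Nat.factorial]
      _ ≤ _ := by linarith
  · have h2 : |u| ^ 2 ≤ |u| ^ (2 + δ) := by
      rw [← Real.rpow_natCast]
      exact Real.rpow_le_rpow_of_exponent_le hu.le (by push_cast; linarith)
    have hn : ‖Complex.exp (u * Complex.I)‖ = 1 := Complex.norm_exp_ofReal_mul_I u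
    calc _ ≤ ‖Complex.exp (u * Complex.I)‖ + (‖(1 : ℂ)‖ + ‖(u * Complex.I : ℂ)‖ + ‖(u ^ 2 / 2 : ℂ)‖) :=
          (norm_sub_le _ _).trans (add_le_add_right ((norm_sub_le _ _).trans
            (add_le_add_left (norm_add_le _ _) _)) _)
      _ = 2 + |u| + |u| ^ 2 / 2 := by
          rw [hn]
          simp
          ring
      _ ≤ 4 * |u| ^ 2 := by nlinarith
      _ ≤ _ := by linarith

lemma norm_charFun_sub_le {δ : ℝ} (hδ₀ : 0 ≤ δ) (hδ₁ : δ ≤ 1) (ν : Measure ℝ)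
    [IsProbabilityMeasure ν] (h1 : ∫ x, x ∂ν = 0) (h2 : ∫ x, x ^ 2 ∂ν = 1)
    (hρ : Integrable (fun x => |x| ^ (2 + δ)) ν) (t : ℝ) :
    ‖charFun ν t - (1 - t ^ 2 / 2 : ℝ)‖ ≤ 4 * (∫ x, |x| ^ (2 + δ) ∂ν) * |t| ^ (2 + δ) := by
  -- The integral of a nonintegrable function is `0` by convention, so the value `1` already forces
  -- integrability.
  have i2 : Integrable (fun x : ℝ => x ^ 2) ν := by
    by_contra h
    rw [integral_undef h] at h2
    norm_num at h2
  have i1 : Integrable (fun x : ℝ => x) ν := by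
    refine ((integrable_const (1 : ℝ)).add i2).mono' (by fun_prop) (.of_forall fun x => ?_)
    simp only [Pi.add_apply, Real.norm_eq_abs]
    nlinarith [sq_abs x, sq_nonneg (|x| - 1), abs_nonneg x]
  have i0 : Integrable (fun x : ℝ => Complex.exp (t * x * Complex.I)) ν := by
    refine Integrable.of_bound (C := 1) (by fun_prop) (.of_forall fun x => ?_)
    exact_mod_cast (Complex.norm_exp_ofReal_mul_I (t * x)).le
  have i3 : Integrable (fun x : ℝ => 1 + (t * x : ℝ) * Complex.I - ((t * x : ℝ) : ℂ) ^ 2 / 2) ν := by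
    refine Integrable.sub ((integrable_const _).add (((i1.const_mul t).ofReal).mul_const _)) ?_
    refine Integrable.div_const ?_ _
    have := (i2.const_mul (t ^ 2)).ofReal (𝕜 := ℂ)
    refine this.congr (.of_forall fun x => ?_)
    simp [mul_pow]
  have e : ∫ x, (1 + (t * x : ℝ) * Complex.I - ((t * x : ℝ) : ℂ) ^ 2 / 2) ∂ν =
      ((1 - t ^ 2 / 2 : ℝ) : ℂ) := by
    have a1 : ∫ x : ℝ, (x : ℂ) ∂ν = 0 := by rw [integral_complex_ofReal, h1]; simp
    have a2 : ∫ x : ℝ, (x : ℂ) ^ 2 ∂ν = 1 := by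
      have : ∫ x : ℝ, ((x ^ 2 : ℝ) : ℂ) ∂ν = 1 := by rw [integral_complex_ofReal, h2]; simp
      simpa using this
    have b1 : Integrable (fun x : ℝ => (x : ℂ)) ν := i1.ofReal
    have b2 : Integrable (fun x : ℝ => (x : ℂ) ^ 2) ν := by
      have := i2.ofReal (𝕜 := ℂ)
      simpa using this
    have c1 : ∀ x : ℝ, (1 + (t * x : ℝ) * Complex.I - ((t * x : ℝ) : ℂ) ^ 2 / 2) =
        (1 : ℂ) + (t * Complex.I) * x - (t ^ 2 / 2) * (x : ℂ) ^ 2 := fun x => by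
      push_cast; ring
    simp_rw [c1]
    have b3 : Integrable (fun x : ℝ => (1 : ℂ) + (t * Complex.I) * x) ν :=
      (integrable_const _).add (b1.const_mul _)
    rw [integral_sub b3 (b2.const_mul _),
      integral_add (integrable_const _) (b1.const_mul _), integral_const_mul, integral_const_mul,
      a1, a2]
    simp
  rw [charFun_apply_real, ← e, ← integral_sub i0 i3]
  rw [mul_assoc, mul_comm (∫ x, |x| ^ (2 + δ) ∂ν), ← mul_assoc, ← integral_const_mul]
  refine norm_integral_le_of_norm_le (hρ.const_mul _) (.of_forall fun x => ?_)
  have h := norm_exp_mul_I_sub_le hδ₀ hδ₁ (t * x)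
  rw [abs_mul, Real.mul_rpow (abs_nonneg _) (abs_nonneg _)] at h
  simpa [mul_assoc] using h

/-- Telescoping. Keeping `M` instead of `1` matters: `M ^ n` later supplies the Gaussian decay in
`t`. -/
lemma norm_pow_sub_pow_le_of_norm_le {a b : ℂ} {M : ℝ} (ha : ‖a‖ ≤ M) (hb : ‖b‖ ≤ M) (n : ℕ) :
    ‖a ^ (n + 1) - b ^ (n + 1)‖ ≤ (n + 1) * ‖a - b‖ * M ^ n := by
  have hM : 0 ≤ M := (norm_nonneg _).trans ha
  induction n with
  | zero => simp
  | succ n ih =>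
    have e : a ^ (n + 1 + 1) - b ^ (n + 1 + 1) =
        a ^ (n + 1) * (a - b) + (a ^ (n + 1) - b ^ (n + 1)) * b := by ring
    rw [e]
    refine (norm_add_le _ _).trans ?_
    rw [norm_mul, norm_mul, norm_pow]
    calc _ ≤ M ^ (n + 1) * ‖a - b‖ + ((n + 1) * ‖a - b‖ * M ^ n) * M := by gcongr
      _ = _ := by push_cast; ring

lemma exists_norm_charFun_bounds {δ : ℝ} (hδ₀ : 0 < δ) (hδ₁ : δ ≤ 1) (ν : Measure ℝ)
    [IsProbabilityMeasure ν] (h1 : ∫ x, x ∂ν = 0) (h2 : ∫ x, x ^ 2 ∂ν = 1)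
    (hρ : Integrable (fun x => |x| ^ (2 + δ)) ν) :
    ∃ r A : ℝ, 0 < r ∧ r ≤ 1 ∧ 0 ≤ A ∧ ∀ s : ℝ, |s| ≤ r →
      ‖charFun ν s‖ ≤ Real.exp (-(s ^ 2 / 4)) ∧
      ‖charFun ν s - Real.exp (-(s ^ 2 / 2))‖ ≤ A * |s| ^ (2 + δ) := by
  set ρ := ∫ x, |x| ^ (2 + δ) ∂ν
  have hρ0 : 0 ≤ ρ := integral_nonneg fun x => by positivity
  -- Chosen so that `4 * ρ * |s| ^ δ ≤ 1 / 4` once `|s| ^ δ ≤ c`: the remainder then eats at most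
  -- half of `s ^ 2 / 2`. The `+ 1` keeps `c` positive without a lower bound on `ρ`.
  set c : ℝ := 1 / (16 * ρ + 1) with hc
  have hc0 : 0 < c := by positivity
  refine ⟨min 1 (c ^ (1 / δ)), 4 * ρ + 1, lt_min one_pos (by positivity), min_le_left _ _,
    by positivity, fun s hs => ?_⟩
  have hs1 : |s| ≤ 1 := hs.trans (min_le_left _ _)
  have hs2 : s ^ 2 ≤ 1 := by rw [← sq_abs]; exact pow_le_one₀ (abs_nonneg _) hs1
  have hsδ : |s| ^ δ ≤ c := by
    calc |s| ^ δ ≤ (c ^ (1 / δ)) ^ δ :=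
          Real.rpow_le_rpow (abs_nonneg _) (hs.trans (min_le_right _ _)) hδ₀.le
      _ = c := by rw [← Real.rpow_mul hc0.le, one_div_mul_cancel hδ₀.ne', Real.rpow_one]
  have hsplit : |s| ^ (2 + δ) = s ^ 2 * |s| ^ δ := by
    rw [Real.rpow_add' (abs_nonneg _) (by linarith)]
    norm_num
  have hmain := norm_charFun_sub_le hδ₀.le hδ₁ ν h1 h2 hρ s
  have hcρ : 4 * ρ * c ≤ 1 / 4 := by
    rw [hc, mul_one_div, div_le_div_iff₀ (by positivity) (by norm_num)]
    linarith
  constructor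
  · calc ‖charFun ν s‖ ≤ ‖charFun ν s - (1 - s ^ 2 / 2 : ℝ)‖ + ‖((1 - s ^ 2 / 2 : ℝ) : ℂ)‖ := by
          have := norm_add_le (charFun ν s - (1 - s ^ 2 / 2 : ℝ)) ((1 - s ^ 2 / 2 : ℝ) : ℂ)
          rwa [sub_add_cancel] at this
      _ ≤ s ^ 2 * (4 * ρ * c) + (1 - s ^ 2 / 2) := by
          rw [Complex.norm_real, Real.norm_eq_abs, abs_of_nonneg (by linarith)]
          refine add_le_add_left (hmain.trans ?_) _
          rw [hsplit]
          calc 4 * ρ * (s ^ 2 * |s| ^ δ) ≤ 4 * ρ * (s ^ 2 * c) := by gcongr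
            _ = _ := by ring
      _ ≤ s ^ 2 * (1 / 4) + (1 - s ^ 2 / 2) := by gcongr
      _ ≤ Real.exp (-(s ^ 2 / 4)) := by
          have := Real.add_one_le_exp (-(s ^ 2 / 4))
          linarith
  · have hexp : |Real.exp (-(s ^ 2 / 2)) - 1 - -(s ^ 2 / 2)| ≤ (-(s ^ 2 / 2)) ^ 2 := by
      refine Real.abs_exp_sub_one_sub_id_le ?_
      rw [abs_neg, abs_of_nonneg (by positivity)]
      linarith
    have h4 : (-(s ^ 2 / 2)) ^ 2 ≤ |s| ^ (2 + δ) := by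
      have : |s| ≤ |s| ^ δ := by
        rcases (abs_nonneg s).eq_or_lt with h0 | h0
        · rw [← h0]; positivity
        · simpa using Real.rpow_le_rpow_of_exponent_ge h0 hs1 hδ₁
      have h5 : s ^ 2 ≤ |s| := by rw [← sq_abs]; nlinarith [abs_nonneg s]
      rw [hsplit]
      calc (-(s ^ 2 / 2)) ^ 2 = s ^ 2 * (s ^ 2 / 4) := by ring
        _ ≤ s ^ 2 * |s| ^ δ := by
            refine mul_le_mul_of_nonneg_left ?_ (sq_nonneg _)
            linarith [sq_nonneg s]
    calc ‖charFun ν s - Real.exp (-(s ^ 2 / 2))‖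
        ≤ ‖charFun ν s - (1 - s ^ 2 / 2 : ℝ)‖ +
          ‖((Real.exp (-(s ^ 2 / 2)) - 1 - -(s ^ 2 / 2) : ℝ) : ℂ)‖ := by
          refine le_trans (le_of_eq ?_) (norm_sub_le _ _)
          congr 1
          push_cast
          ring
      _ ≤ 4 * ρ * |s| ^ (2 + δ) + |s| ^ (2 + δ) := by
          rw [Complex.norm_real, Real.norm_eq_abs]
          exact add_le_add hmain (hexp.trans h4)
      _ = _ := by ring

lemma norm_charFun_pow_sub_le {δ A r : ℝ} (hr1 : r ≤ 1) (hA : 0 ≤ A)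
    (ν : Measure ℝ)
    (h : ∀ s : ℝ, |s| ≤ r → ‖charFun ν s‖ ≤ Real.exp (-(s ^ 2 / 4)) ∧
      ‖charFun ν s - Real.exp (-(s ^ 2 / 2))‖ ≤ A * |s| ^ (2 + δ))
    {n : ℕ} (hn : 1 ≤ n) {t : ℝ} (ht : |t| ≤ r * √n) :
    ‖charFun ν ((√n)⁻¹ * t) ^ n - Real.exp (-(t ^ 2 / 2))‖ ≤
      2 * A * (n : ℝ) ^ (-(δ / 2)) * |t| ^ (2 + δ) * Real.exp (-(t ^ 2 / 4)) := by
  have hn0 : (0 : ℝ) < n := by exact_mod_cast hn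
  have hsn : 0 < √(n : ℝ) := Real.sqrt_pos.mpr hn0
  set s := (√n)⁻¹ * t with hs
  have hsabs : |s| = |t| / √n := by
    rw [hs, abs_mul, abs_of_pos (inv_pos.mpr hsn)]; ring
  have hsr : |s| ≤ r := by rw [hsabs, div_le_iff₀ hsn]; exact ht
  have hs2 : s ^ 2 ≤ 1 := by
    rw [← sq_abs]; exact pow_le_one₀ (abs_nonneg _) (hsr.trans hr1)
  have hst : n * s ^ 2 = t ^ 2 := by
    rw [hs, mul_pow, inv_pow, Real.sq_sqrt hn0.le, mul_inv_cancel_left₀ hn0.ne']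
  obtain ⟨m, rfl⟩ : ∃ m, n = m + 1 := ⟨n - 1, by omega⟩
  obtain ⟨ha, hab⟩ := h s hsr
  have hb : ‖((Real.exp (-(s ^ 2 / 2)) : ℝ) : ℂ)‖ ≤ Real.exp (-(s ^ 2 / 4)) := by
    rw [Complex.norm_real, Real.norm_eq_abs, Real.abs_exp]
    exact Real.exp_le_exp.mpr (by linarith [sq_nonneg s])
  have hpow := norm_pow_sub_pow_le_of_norm_le ha hb m
  have e1 : ((Real.exp (-(s ^ 2 / 2)) : ℝ) : ℂ) ^ (m + 1) = (Real.exp (-(t ^ 2 / 2)) : ℝ) := by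
    rw [← Complex.ofReal_pow, ← Real.exp_nat_mul, ← hst]
    congr 2
    ring
  rw [e1] at hpow
  -- Only `n - 1` factors are available; the missing one costs `exp (s ^ 2 / 4) ≤ 2`.
  have e2 : Real.exp (-(s ^ 2 / 4)) ^ m ≤ 2 * Real.exp (-(t ^ 2 / 4)) := by
    rw [← Real.exp_nat_mul, ← hst]
    have : (m : ℝ) * -(s ^ 2 / 4) = s ^ 2 / 4 + -(((m + 1 : ℕ) : ℝ) * s ^ 2 / 4) := by
      push_cast; ring
    rw [this, Real.exp_add]
    refine mul_le_mul_of_nonneg_right ?_ (Real.exp_nonneg _)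
    have hq : |s ^ 2 / 4| ≤ 1 := by rw [abs_of_nonneg (by positivity)]; linarith
    have := abs_le.mp (Real.abs_exp_sub_one_le hq)
    rw [abs_of_nonneg (by positivity)] at this
    linarith [this.2]
  have e3 : ((m : ℝ) + 1) * |s| ^ (2 + δ) =
      ((m + 1 : ℕ) : ℝ) ^ (-(δ / 2)) * |t| ^ (2 + δ) := by
    rw [hsabs, Real.div_rpow (abs_nonneg _) hsn.le, Real.sqrt_eq_rpow, ← Real.rpow_mul hn0.le]
    have : ((m + 1 : ℕ) : ℝ) ^ (1 / 2 * (2 + δ)) =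
        ((m : ℝ) + 1) * (((m + 1 : ℕ) : ℝ) ^ (-(δ / 2)))⁻¹ := by
      rw [← Real.rpow_neg hn0.le, show 1 / 2 * (2 + δ) = 1 + - -(δ / 2) by ring,
        Real.rpow_add hn0, Real.rpow_one]
      push_cast
      rfl
    rw [this]
    have h1 : ((m : ℝ) + 1) ≠ 0 := by positivity
    have h2 : ((m + 1 : ℕ) : ℝ) ^ (-(δ / 2)) ≠ 0 := by positivity
    field_simp
  refine hpow.trans ?_
  calc ((m : ℝ) + 1) * ‖charFun ν s - (Real.exp (-(s ^ 2 / 2)) : ℝ)‖ * Real.exp (-(s ^ 2 / 4)) ^ m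
      ≤ ((m : ℝ) + 1) * (A * |s| ^ (2 + δ)) * (2 * Real.exp (-(t ^ 2 / 4))) := by gcongr
    _ = 2 * A * (((m : ℝ) + 1) * |s| ^ (2 + δ)) * Real.exp (-(t ^ 2 / 4)) := by ring
    _ = _ := by rw [e3]; ring

/-! ### The Berry–Esseen bound. -/

lemma integrable_one_add_sq_mul_exp_neg :
    Integrable (fun t : ℝ => (1 + t ^ 2) * Real.exp (-(t ^ 2 / 4))) := by
  have a1 := integrable_exp_neg_mul_sq (b := 1 / 4) (by norm_num)
  have a2 := integrable_rpow_mul_exp_neg_mul_sq (b := 1 / 4) (by norm_num) (s := 2) (by norm_num)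
  refine (a1.add a2).congr (.of_forall fun t => ?_)
  simp only [Pi.add_apply, Real.rpow_two]
  rw [show -(1 / 4) * t ^ 2 = -(t ^ 2 / 4) by ring]
  ring

/-- Berry–Esseen bound under a moment of order `2 + δ`, for a law whose characteristic function
is that of a normalised sum of `n` independent variables of law `ν`. -/
lemma exists_abs_cdf_sub_cdf_gaussianReal_le {δ : ℝ} (hδ₀ : 0 < δ) (hδ₁ : δ ≤ 1 / 2)
    (ν : Measure ℝ) [IsProbabilityMeasure ν] (h1 : ∫ x, x ∂ν = 0) (h2 : ∫ x, x ^ 2 ∂ν = 1)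
    (hρ : Integrable (fun x => |x| ^ (2 + δ)) ν) :
    ∃ C : ℝ, ∀ n : ℕ, 1 ≤ n → ∀ μ : Measure ℝ, IsProbabilityMeasure μ →
      (∀ t, charFun μ t = charFun ν ((√n)⁻¹ * t) ^ n) →
      ∀ x, |cdf μ x - cdf (gaussianReal 0 1) x| ≤ C * (n : ℝ) ^ (-(δ / 2)) := by
  obtain ⟨r, A, hr0, hr1, hA, hb⟩ := exists_norm_charFun_bounds hδ₀ (by linarith) ν h1 h2 hρ
  set f : ℝ → ℝ := fun t => (1 + t ^ 2) * Real.exp (-(t ^ 2 / 4)) with hf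
  have hf0 : ∀ t, 0 ≤ f t := fun t => by positivity
  set J := ∫ t, f t
  have hJ0 : 0 ≤ J := integral_nonneg hf0
  refine ⟨2 * (4 * A * J + 4 / r) + 8, fun n hn μ hμ hφ x => ?_⟩
  have hn0 : (0 : ℝ) < n := by exact_mod_cast hn
  have hn1 : (1 : ℝ) ≤ n := by exact_mod_cast hn
  have hsn : 0 < √(n : ℝ) := Real.sqrt_pos.mpr hn0
  set ε := (n : ℝ) ^ (-(δ / 2)) with hε
  have hε0 : 0 < ε := by positivity
  set v : ℝ≥0 := ⟨ε ^ 2, sq_nonneg _⟩ with hv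
  have hvc : (v : ℝ) = ε ^ 2 := rfl
  have hv0 : v ≠ 0 := by
    rw [← NNReal.coe_ne_zero, hvc]; positivity
  have hvs : √(v : ℝ) = ε := by rw [hvc, Real.sqrt_sq hε0.le]
  -- The first term serves `|t| ≤ r * √n`. Beyond that range the trivial bound `2` is at most `|t|`
  -- times the second term.
  set g : ℝ → ℝ := fun t => 2 * A * ε * f t + 2 / (r * √n) with hg
  have hle := gaussianReal_le_smul_volume (inv_ne_zero hv0) 0
  have hfi' : Integrable f (ENNReal.ofReal (√(2 * Real.pi * (v⁻¹ : ℝ≥0)))⁻¹ • volume) :=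
    integrable_one_add_sq_mul_exp_neg.smul_measure ENNReal.ofReal_ne_top
  have hfi : Integrable f (gaussianReal 0 v⁻¹) := hfi'.mono_measure hle
  have hfint : ∫ t, f t ∂gaussianReal 0 v⁻¹ ≤ (√(2 * Real.pi * (v⁻¹ : ℝ≥0)))⁻¹ * J := by
    refine (integral_mono_measure hle (.of_forall hf0) hfi').trans (le_of_eq ?_)
    rw [integral_smul_measure, ENNReal.toReal_ofReal (by positivity), smul_eq_mul]
  have hgi : Integrable g (gaussianReal 0 v⁻¹) := (hfi.const_mul _).add (integrable_const _)
  have hg0 : ∀ t, 0 ≤ g t := fun t => by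
    have := hf0 t
    positivity
  have hchar : ∀ t, ‖charFun μ t - charFun (gaussianReal 0 1) t‖ ≤ |t| * g t := by
    intro t
    have hG : charFun (gaussianReal 0 1) t = (Real.exp (-(t ^ 2 / 2)) : ℝ) := by
      rw [charFun_gaussianReal]
      push_cast
      congr 1
      ring
    rcases le_or_gt |t| (r * √n) with ht | ht
    · rw [hφ, hG]
      refine (norm_charFun_pow_sub_le hr1 hA ν hb hn ht).trans ?_
      have hpow : |t| ^ (2 + δ) ≤ |t| * (1 + t ^ 2) := by
        rw [show 2 + δ = 1 + (1 + δ) by ring, Real.rpow_add' (abs_nonneg _) (by linarith),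
          Real.rpow_one]
        refine mul_le_mul_of_nonneg_left ?_ (abs_nonneg _)
        rcases le_or_gt |t| 1 with h | h
        · have := Real.rpow_le_one (abs_nonneg t) h (by linarith : 0 ≤ 1 + δ)
          linarith [sq_nonneg t]
        · have := Real.rpow_le_rpow_of_exponent_le h.le (by linarith : 1 + δ ≤ 2)
          rw [Real.rpow_two, sq_abs] at this
          linarith
      calc 2 * A * ε * |t| ^ (2 + δ) * Real.exp (-(t ^ 2 / 4))
          ≤ 2 * A * ε * (|t| * (1 + t ^ 2)) * Real.exp (-(t ^ 2 / 4)) := by gcongr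
        _ = |t| * (2 * A * ε * f t) := by simp only [hf]; ring
        _ ≤ |t| * g t := by
            refine mul_le_mul_of_nonneg_left ?_ (abs_nonneg _)
            simp only [hg]
            have : 0 ≤ 2 / (r * √n) := by positivity
            linarith
    · calc _ ≤ ‖charFun μ t‖ + ‖charFun (gaussianReal 0 1) t‖ := norm_sub_le _ _
        _ ≤ 1 + 1 := add_le_add (norm_charFun_le_one _) (norm_charFun_le_one _)
        _ ≤ |t| * (2 / (r * √n)) := by
            rw [mul_div_assoc', le_div_iff₀ (by positivity)]
            linarith
        _ ≤ |t| * g t := by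
            refine mul_le_mul_of_nonneg_left ?_ (abs_nonneg _)
            simp only [hg]
            have := hf0 t
            have : 0 ≤ 2 * A * ε * f t := by positivity
            linarith
  have hpi : 1 ≤ 2 * Real.pi := by linarith [Real.pi_gt_three]
  have hc1 : (√(2 * Real.pi * v))⁻¹ ≤ ε⁻¹ := by
    refine inv_anti₀ hε0 ?_
    rw [← hvs]
    refine Real.sqrt_le_sqrt ?_
    exact le_mul_of_one_le_left v.2 hpi
  -- The prefactors of the two dual Gaussians cancel up to `2π`, so the `f` term suffers no loss
  -- from the small smoothing width.
  have hc2 : (√(2 * Real.pi * v))⁻¹ * (√(2 * Real.pi * (v⁻¹ : ℝ≥0)))⁻¹ ≤ 1 := by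
    rw [← mul_inv, ← Real.sqrt_mul (by positivity)]
    refine inv_le_one_of_one_le₀ (Real.one_le_sqrt.mpr ?_)
    have : (v : ℝ) ≠ 0 := by exact_mod_cast hv0
    rw [NNReal.coe_inv]
    field_simp
    nlinarith
  -- The high-frequency term does pay `ε⁻¹`; this is affordable exactly because `δ ≤ 1 / 2`.
  have hεn : ε⁻¹ * (√(n : ℝ))⁻¹ ≤ ε := by
    rw [hε, ← Real.rpow_neg hn0.le, Real.sqrt_eq_rpow, ← Real.rpow_neg hn0.le,
      ← Real.rpow_add hn0]
    exact Real.rpow_le_rpow_of_exponent_le hn1 (by linarith)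
  have hB : ∀ x, |∫ z, (cdf μ (x - z) - cdf (gaussianReal 0 1) (x - z)) ∂gaussianReal 0 v| ≤
      (4 * A * J + 4 / r) * ε := by
    intro x
    refine (abs_integral_cdf_sub_cdf_gaussian_le hv0 μ _ g hgi hg0 hchar x).trans ?_
    have e : ∫ t, g t ∂gaussianReal 0 v⁻¹ =
        2 * A * ε * ∫ t, f t ∂gaussianReal 0 v⁻¹ + 2 / (r * √n) := by
      simp only [hg]
      rw [integral_add (hfi.const_mul _) (integrable_const _), integral_const_mul]
      simp
    rw [e]
    calc 2 * (√(2 * Real.pi * v))⁻¹ *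
          (2 * A * ε * ∫ t, f t ∂gaussianReal 0 v⁻¹ + 2 / (r * √n))
        ≤ 2 * (√(2 * Real.pi * v))⁻¹ *
          (2 * A * ε * ((√(2 * Real.pi * (v⁻¹ : ℝ≥0)))⁻¹ * J) + 2 / (r * √n)) := by gcongr
      _ = 4 * A * J * ε * ((√(2 * Real.pi * v))⁻¹ * (√(2 * Real.pi * (v⁻¹ : ℝ≥0)))⁻¹) +
          4 / r * ((√(2 * Real.pi * v))⁻¹ * (√n)⁻¹) := by
          field_simp
          ring
      _ ≤ 4 * A * J * ε * 1 + 4 / r * (ε⁻¹ * (√n)⁻¹) := by gcongr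
      _ ≤ 4 * A * J * ε * 1 + 4 / r * ε := by gcongr
      _ = _ := by ring
  have := abs_cdf_sub_cdf_le_of_smoothed hv0 μ (gaussianReal 0 1)
    (fun a b hab => cdf_gaussianReal_sub_le hab) _ hB x
  rw [hvs] at this
  linarith

/-! ### Pathwise bounds on the relative entropy of the sample. -/

section Sample

variable {Ω A : Type*}

lemma sum_sampleProportion_mul [DecidableEq A] (X : ℕ → Ω → A) (n : ℕ) (ω : Ω) (s : Finset A)
    (f : A → ℝ) :
    ∑ x ∈ s, sampleProportion X n ω x * f x =
      (1 / (n : ℝ)) * ∑ k ∈ Finset.range n, if X k ω ∈ s then f (X k ω) else 0 := by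
  simp only [sampleProportion, mul_assoc]
  rw [← Finset.mul_sum]
  congr 1
  simp_rw [Finset.sum_mul]
  rw [Finset.sum_comm]
  refine Finset.sum_congr rfl fun k _ => ?_
  simp [Set.indicator_apply]

lemma sampleProportion_nonneg (X : ℕ → Ω → A) (n : ℕ) (ω : Ω) (x : A) :
    0 ≤ sampleProportion X n ω x :=
  mul_nonneg (by positivity) (Finset.sum_nonneg fun _ _ =>
    Set.indicator_nonneg (fun _ _ => zero_le_one) _)

lemma sampleProportion_le_one (X : ℕ → Ω → A) (n : ℕ) (ω : Ω) (x : A) :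
    sampleProportion X n ω x ≤ 1 := by
  have h : ∑ k ∈ Finset.range n, Set.indicator {ω' | X k ω' = x} (fun _ => (1 : ℝ)) ω ≤ n := by
    refine (Finset.sum_le_card_nsmul _ _ 1 fun k _ => ?_).trans (by simp)
    exact Set.indicator_le_self' (fun _ _ => zero_le_one) _
  rw [sampleProportion, one_div_mul_eq_div]
  exact div_le_one_of_le₀ h (Nat.cast_nonneg n)

lemma sampleProportion_eq_zero [DecidableEq A] (X : ℕ → Ω → A) (n : ℕ) (ω : Ω) (x : A)
    (hx : x ∉ (Finset.range n).image fun k => X k ω) : sampleProportion X n ω x = 0 := by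
  rw [sampleProportion, Finset.sum_eq_zero, mul_zero]
  intro k hk
  refine Set.indicator_of_notMem (fun h => hx ?_) _
  exact Finset.mem_image.mpr ⟨k, hk, h⟩

lemma sampleProportion_pos [DecidableEq A] (X : ℕ → Ω → A) (n : ℕ) (ω : Ω) (x : A)
    (hx : x ∈ (Finset.range n).image fun k => X k ω) : 0 < sampleProportion X n ω x := by
  obtain ⟨k, hk, hkx⟩ := Finset.mem_image.mp hx
  have hn : 0 < n := by have := Finset.mem_range.mp hk; omega
  refine mul_pos (by positivity) ?_
  refine Finset.sum_pos' (fun _ _ => Set.indicator_nonneg (fun _ _ => zero_le_one) _) ⟨k, hk, ?_⟩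
  rw [Set.indicator_of_mem (show ω ∈ {ω' | X k ω' = x} from hkx)]
  exact one_pos

/-- The plug-in entropy differs from the empirical mean of `-log p` by the relative entropy of the
sample proportions with respect to `p`. -/
lemma mean_sub_plugInEntropy_eq [DecidableEq A] (p : A → ℝ) (X : ℕ → Ω → A) (n : ℕ) (ω : Ω) :
    (1 / (n : ℝ)) * ∑ k ∈ Finset.range n, -Real.log (p (X k ω)) - plugInEntropy X n ω =
      ∑ x ∈ (Finset.range n).image fun k => X k ω, sampleProportion X n ω x *
        (Real.log (sampleProportion X n ω x) - Real.log (p x)) := by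
  set s := (Finset.range n).image fun k => X k ω
  have h1 : plugInEntropy X n ω =
      -∑ x ∈ s, sampleProportion X n ω x * Real.log (sampleProportion X n ω x) := by
    rw [plugInEntropy, shannonEntropy, tsum_eq_sum]
    intro x hx
    rw [sampleProportion_eq_zero X n ω x hx, zero_mul]
  have h2 := sum_sampleProportion_mul X n ω s fun x => -Real.log (p x)
  have h3 : ∑ k ∈ Finset.range n, (if X k ω ∈ s then -Real.log (p (X k ω)) else 0) =
      ∑ k ∈ Finset.range n, -Real.log (p (X k ω)) :=
    Finset.sum_congr rfl fun k hk => if_pos (Finset.mem_image_of_mem _ hk)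
  rw [h3] at h2
  rw [← h2, h1, sub_neg_eq_add, ← Finset.sum_add_distrib]
  refine Finset.sum_congr rfl fun x _ => ?_
  ring

/-- Gibbs' inequality: apply `log u ≤ u - 1` to the ratio of `p` to the sample proportion. The
sampled letters have total proportion `1` and total `p`-mass at most `1`. -/
lemma plugInEntropy_le_mean {p : A → ℝ} (hp_nonneg : ∀ x, 0 ≤ p x) (hp_sum : HasSum p 1)
    (X : ℕ → Ω → A) {n : ℕ} (hn : 1 ≤ n) (ω : Ω) (hω : ∀ k, 0 < p (X k ω)) :
    0 ≤ (1 / (n : ℝ)) * ∑ k ∈ Finset.range n, -Real.log (p (X k ω)) - plugInEntropy X n ω := by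
  classical
  rw [mean_sub_plugInEntropy_eq]
  set s := (Finset.range n).image fun k => X k ω with hs
  have hone : ∑ x ∈ s, sampleProportion X n ω x = 1 := by
    have h := sum_sampleProportion_mul X n ω s fun _ => 1
    simp only [mul_one] at h
    have hn0 : (n : ℝ) ≠ 0 := by positivity
    rw [h, Finset.sum_congr rfl fun k hk => if_pos (Finset.mem_image_of_mem _ hk)]
    simp [hn0]
  have hp1 : ∑ x ∈ s, p x ≤ 1 := sum_le_hasSum s (fun x _ => hp_nonneg x) hp_sum
  calc (0 : ℝ) ≤ ∑ x ∈ s, (sampleProportion X n ω x - p x) := by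
        rw [Finset.sum_sub_distrib, hone]; linarith
    _ ≤ _ := Finset.sum_le_sum fun x hx => ?_
  have hq := sampleProportion_pos X n ω x hx
  obtain ⟨k, -, rfl⟩ := Finset.mem_image.mp hx
  have h := Real.log_le_sub_one_of_pos (div_pos (hω k) hq)
  rw [Real.log_div (hω k).ne' hq.ne'] at h
  have h2 := mul_le_mul_of_nonneg_left h hq.le
  rw [mul_sub, mul_sub, mul_div_cancel₀ _ hq.ne'] at h2
  linarith

/-- On `S`, `log u ≤ u - 1` for the inverse ratio bounds relative entropy by a chi-square quantity,
whose mean is computable. Off `S`, the nonpositive logarithm of the sample proportion is dropped. -/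
lemma mean_sub_plugInEntropy_le [DecidableEq A] {p : A → ℝ}
    (X : ℕ → Ω → A) (n : ℕ) (ω : Ω) (hω : ∀ k, 0 < p (X k ω)) (S : Finset A) :
    (1 / (n : ℝ)) * ∑ k ∈ Finset.range n, -Real.log (p (X k ω)) - plugInEntropy X n ω ≤
      ∑ x ∈ S, sampleProportion X n ω x * (sampleProportion X n ω x / p x - 1) +
        (1 / (n : ℝ)) * ∑ k ∈ Finset.range n,
          if X k ω ∈ S then 0 else -Real.log (p (X k ω)) := by
  rw [mean_sub_plugInEntropy_eq]
  set s := (Finset.range n).image fun k => X k ω with hs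
  rw [← Finset.sum_filter_add_sum_filter_not s (· ∈ S)]
  refine add_le_add ?_ ?_
  · calc _ ≤ ∑ x ∈ s with x ∈ S,
          sampleProportion X n ω x * (sampleProportion X n ω x / p x - 1) := by
          refine Finset.sum_le_sum fun x hx => ?_
          have hxs := (Finset.mem_filter.mp hx).1
          have hq := sampleProportion_pos X n ω x hxs
          obtain ⟨k, -, rfl⟩ := Finset.mem_image.mp hxs
          refine mul_le_mul_of_nonneg_left ?_ hq.le
          rw [← Real.log_div hq.ne' (hω k).ne']
          exact Real.log_le_sub_one_of_pos (div_pos hq (hω k))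
      _ = _ := by
          refine Finset.sum_subset (fun x hx => (Finset.mem_filter.mp hx).2) fun x hx hx' => ?_
          rw [sampleProportion_eq_zero X n ω x fun h => hx' (Finset.mem_filter.mpr ⟨h, hx⟩),
            zero_mul]
  · calc _ ≤ ∑ x ∈ s with x ∉ S, sampleProportion X n ω x * -Real.log (p x) := by
          refine Finset.sum_le_sum fun x hx => ?_
          refine mul_le_mul_of_nonneg_left ?_ (sampleProportion_nonneg X n ω x)
          have := Real.log_nonpos (sampleProportion_nonneg X n ω x)
            (sampleProportion_le_one X n ω x)
          linarith
      _ = _ := by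
          rw [sum_sampleProportion_mul]
          congr 1
          refine Finset.sum_congr rfl fun k hk => ?_
          have : X k ω ∈ s := Finset.mem_image_of_mem _ hk
          by_cases h : X k ω ∈ S <;> simp [h, this]

end Sample

/-! ### Moments of the sample proportions and a Markov bound. -/

section Moments

variable {Ω A : Type*} [MeasurableSpace Ω] [MeasurableSpace A] [MeasurableSingletonClass A]
  {P : Measure Ω} [IsProbabilityMeasure P] {X : ℕ → Ω → A}

lemma measurable_sampleProportion (hX : ∀ k, Measurable (X k)) (n : ℕ) (x : A) :
    Measurable fun ω => sampleProportion X n ω x := by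
  refine measurable_const.mul (Finset.measurable_fun_sum _ fun k _ => ?_)
  exact measurable_const.indicator (hX k (measurableSet_singleton x))

lemma integrable_sampleProportion (hX : ∀ k, Measurable (X k)) (n : ℕ) (x : A) :
    Integrable (fun ω => sampleProportion X n ω x) P :=
  Integrable.of_bound (C := 1) (measurable_sampleProportion hX n x).aestronglyMeasurable
    (.of_forall fun ω => by
      rw [Real.norm_eq_abs, abs_of_nonneg (sampleProportion_nonneg X n ω x)]
      exact sampleProportion_le_one X n ω x)

lemma integrable_sampleProportion_sq (hX : ∀ k, Measurable (X k)) (n : ℕ) (x : A) :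
    Integrable (fun ω => sampleProportion X n ω x ^ 2) P :=
  Integrable.of_bound (C := 1) ((measurable_sampleProportion hX n x).pow_const 2).aestronglyMeasurable
    (.of_forall fun ω => by
      rw [Real.norm_eq_abs, abs_of_nonneg (sq_nonneg _)]
      exact pow_le_one₀ (sampleProportion_nonneg X n ω x) (sampleProportion_le_one X n ω x))

lemma integral_sampleProportion {p : A → ℝ} (hX : ∀ k, Measurable (X k))
    (hXp : ∀ k x, P.real {ω | X k ω = x} = p x) {n : ℕ} (hn : 1 ≤ n) (x : A) :
    ∫ ω, sampleProportion X n ω x ∂P = p x := by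
  have hn0 : (n : ℝ) ≠ 0 := by positivity
  have hm : ∀ k, MeasurableSet {ω | X k ω = x} := fun k => hX k (measurableSet_singleton x)
  simp only [sampleProportion]
  rw [integral_const_mul, integral_finsetSum _ fun k _ => (integrable_const _).indicator (hm k)]
  simp_rw [integral_indicator_const (1 : ℝ) (hm _), hXp]
  simp [hn0]

lemma integral_sampleProportion_sq_le {p : A → ℝ} (hX : ∀ k, Measurable (X k))
    (hind : iIndepFun X P) (hXp : ∀ k x, P.real {ω | X k ω = x} = p x) {n : ℕ} (hn : 1 ≤ n)
    (x : A) : ∫ ω, sampleProportion X n ω x ^ 2 ∂P ≤ p x ^ 2 + p x / n := by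
  have hn0 : (n : ℝ) ≠ 0 := by positivity
  have hm : ∀ k, MeasurableSet {ω | X k ω = x} := fun k => hX k (measurableSet_singleton x)
  set Y : ℕ → Ω → ℝ := fun k => Set.indicator {ω' | X k ω' = x} fun _ => (1 : ℝ)
  have hYm : ∀ k, Measurable (Y k) := fun k => measurable_const.indicator (hm k)
  have hY2 : ∀ k, MemLp (Y k) 2 P := fun k => (memLp_const (1 : ℝ)).indicator (hm k)
  have hYi : Set.Pairwise (Finset.range n : Set ℕ) fun i j => IndepFun (Y i) (Y j) P := by
    intro i _ j _ hij
    have hφ : Measurable (Set.indicator {x} fun _ => (1 : ℝ)) :=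
      measurable_const.indicator (measurableSet_singleton x)
    exact (hind.indepFun hij).comp hφ hφ
  have hvar := IndepFun.variance_sum (fun k _ => hY2 k) hYi
  have hvY : ∀ k, Var[Y k; P] ≤ p x := by
    intro k
    refine (variance_le_expectation_sq (hYm k).aestronglyMeasurable).trans (le_of_eq ?_)
    have e : Y k ^ 2 = Y k := by
      ext ω
      simp only [Y, Pi.pow_apply, Set.indicator]
      split_ifs <;> norm_num
    rw [e, integral_indicator_const (1 : ℝ) (hm k), hXp]
    simp
  have hq2 : MemLp (fun ω => sampleProportion X n ω x) 2 P :=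
    (memLp_two_iff_integrable_sq (measurable_sampleProportion hX n x).aestronglyMeasurable).mpr
      (integrable_sampleProportion_sq hX n x)
  have hsub := variance_eq_sub hq2
  rw [integral_sampleProportion hX hXp hn] at hsub
  have hvq : Var[fun ω => sampleProportion X n ω x; P] ≤ p x / n := by
    have e : (fun ω => sampleProportion X n ω x) =
        fun ω => (1 / (n : ℝ)) * (∑ k ∈ Finset.range n, Y k) ω := by
      ext ω
      simp [sampleProportion, Y]
    rw [e, variance_const_mul, hvar]
    calc (1 / (n : ℝ)) ^ 2 * ∑ k ∈ Finset.range n, Var[Y k; P]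
        ≤ (1 / (n : ℝ)) ^ 2 * ∑ k ∈ Finset.range n, p x := by
          gcongr with k _
          exact hvY k
      _ = p x / n := by
          simp
          field_simp
  simp only [Pi.pow_apply] at hsub
  linarith

/-- The variance of order `p x / n` is divided by `p x`, so the bound does not depend on how rare
the letter is; summing over the head costs only its cardinality over `n`. -/
lemma integral_sampleProportion_mul_le {p : A → ℝ} (hX : ∀ k, Measurable (X k))
    (hind : iIndepFun X P) (hXp : ∀ k x, P.real {ω | X k ω = x} = p x) {n : ℕ} (hn : 1 ≤ n)
    (x : A) :
    ∫ ω, sampleProportion X n ω x * (sampleProportion X n ω x / p x - 1) ∂P ≤ 1 / n := by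
  have e : ∀ ω, sampleProportion X n ω x * (sampleProportion X n ω x / p x - 1) =
      (p x)⁻¹ * sampleProportion X n ω x ^ 2 - sampleProportion X n ω x := fun ω => by ring
  simp_rw [e]
  rw [integral_sub ((integrable_sampleProportion_sq hX n x).const_mul _)
    (integrable_sampleProportion hX n x), integral_const_mul, integral_sampleProportion hX hXp hn]
  have hp0 : 0 ≤ p x := by rw [← hXp 0 x]; exact measureReal_nonneg
  rcases hp0.eq_or_lt with h0 | h0
  · rw [← h0]
    simp
  · have h := integral_sampleProportion_sq_le hX hind hXp hn x
    calc _ ≤ (p x)⁻¹ * (p x ^ 2 + p x / n) - p x := by gcongr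
      _ = 1 / n := by field_simp; ring

/-- The expected relative entropy of the sample proportions is at most `#S / n` plus the tail
entropy outside `S`, in the form of a Markov bound. -/
lemma mul_measureReal_le_of_mean_sub_plugInEntropy [Countable A] [DecidableEq A] {p : A → ℝ}
    (hp_nonneg : ∀ x, 0 ≤ p x)
    (hp_sum : HasSum p 1) (hX : ∀ k, Measurable (X k))
    (hind : iIndepFun X P) (hXp : ∀ k x, P.real {ω | X k ω = x} = p x)
    (μ : Measure A) (hμ : ∀ k, P.map (X k) = μ) (hpos : ∀ᵐ ω ∂P, ∀ k, 0 < p (X k ω))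
    (hlog : Integrable (fun x => Real.log (p x)) μ) {n : ℕ} (hn : 1 ≤ n) (S : Finset A) (η : ℝ) :
    η * P.real {ω | η ≤ (1 / (n : ℝ)) * ∑ k ∈ Finset.range n, -Real.log (p (X k ω)) -
      plugInEntropy X n ω} ≤ S.card / n + ∫ x, (if x ∈ S then 0 else -Real.log (p x)) ∂μ := by
  rcases le_or_gt η 0 with hη | hη
  · refine (mul_nonpos_of_nonpos_of_nonneg hη measureReal_nonneg).trans
      (add_nonneg (by positivity) (integral_nonneg fun x => ?_))
    dsimp only
    split_ifs
    · exact le_rfl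
    · have := Real.log_nonpos (hp_nonneg x)
        (by simpa using sum_le_hasSum {x} (fun y _ => hp_nonneg y) hp_sum)
      simp only [Pi.zero_apply]
      linarith
  have hn0 : (n : ℝ) ≠ 0 := by positivity
  set g : A → ℝ := fun x => if x ∈ S then 0 else -Real.log (p x) with hg
  have hgi : Integrable g μ := by
    refine hlog.mono (Measurable.of_discrete).aestronglyMeasurable (.of_forall fun x => ?_)
    simp only [hg]
    split_ifs <;> simp
  have hgX : ∀ k, Integrable (fun ω => g (X k ω)) P := fun k => by
    rw [← hμ k] at hgi
    exact hgi.comp_measurable (hX k)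
  have hgE : ∀ k, ∫ ω, g (X k ω) ∂P = ∫ x, g x ∂μ := fun k => by
    rw [← hμ k, integral_map (hX k).aemeasurable (Measurable.of_discrete).aestronglyMeasurable]
  have hqi : ∀ x, Integrable (fun ω =>
      sampleProportion X n ω x * (sampleProportion X n ω x / p x - 1)) P := fun x => by
    refine (((integrable_sampleProportion_sq hX n x).const_mul (p x)⁻¹).sub
      (integrable_sampleProportion hX n x)).congr (.of_forall fun ω => ?_)
    simp only [Pi.sub_apply]
    ring
  set U : Ω → ℝ := fun ω =>
    ∑ x ∈ S, sampleProportion X n ω x * (sampleProportion X n ω x / p x - 1) +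
      (1 / (n : ℝ)) * ∑ k ∈ Finset.range n, g (X k ω) with hU
  have hU1 : Integrable (fun ω =>
      ∑ x ∈ S, sampleProportion X n ω x * (sampleProportion X n ω x / p x - 1)) P :=
    integrable_finsetSum _ fun x _ => hqi x
  have hU2 : Integrable (fun ω => (1 / (n : ℝ)) * ∑ k ∈ Finset.range n, g (X k ω)) P :=
    (integrable_finsetSum _ fun k _ => hgX k).const_mul _
  have hUE : ∫ ω, U ω ∂P ≤ S.card / n + ∫ x, g x ∂μ := by
    simp only [hU]
    rw [integral_add hU1 hU2, integral_finsetSum _ fun x _ => hqi x, integral_const_mul,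
      integral_finsetSum _ fun k _ => hgX k]
    refine add_le_add ?_ (le_of_eq ?_)
    · refine (Finset.sum_le_card_nsmul _ _ _ fun x _ =>
        integral_sampleProportion_mul_le hX hind hXp hn x).trans (le_of_eq ?_)
      simp [div_eq_mul_inv]
    · simp_rw [hgE]
      simp [hn0]
  have hle : ∀ᵐ ω ∂P, (1 / (n : ℝ)) * ∑ k ∈ Finset.range n, -Real.log (p (X k ω)) -
      plugInEntropy X n ω ≤ U ω := by
    filter_upwards [hpos] with ω hω
    exact mean_sub_plugInEntropy_le X n ω hω S
  -- Markov's inequality needs `U` nonnegative, which its formula does not show: it dominates the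
  -- relative entropy, nonnegative by Gibbs.
  have hU0 : 0 ≤ᵐ[P] U := by
    filter_upwards [hpos, hle] with ω hω h
    exact (plugInEntropy_le_mean hp_nonneg hp_sum X hn ω hω).trans h
  refine le_trans ?_ ((mul_meas_ge_le_integral_of_nonneg hU0 (hU1.add hU2) η).trans hUE)
  refine mul_le_mul_of_nonneg_left ?_ hη.le
  refine ENNReal.toReal_mono (measure_ne_top _ _) (measure_mono_ae ?_)
  filter_upwards [hle] with ω h h2
  exact le_trans h2 h

end Moments

/-! ### Normal approximation for i.i.d. sums. -/

/-- Berry–Esseen bound for a function of i.i.d. observations, under a moment of order `2 + δ`. -/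
lemma exists_abs_measureReal_sum_le_sub_cdf_le.{u, v} {A : Type u} [MeasurableSpace A] {δ : ℝ}
    (hδ₀ : 0 < δ)
    (hδ₁ : δ ≤ 1 / 2) (μ : Measure A) [IsProbabilityMeasure μ] {f : A → ℝ} (hf : Measurable f)
    (hfδ : MemLp f (ENNReal.ofReal (2 + δ)) μ) (hvar : Var[f; μ] ≠ 0) :
    ∃ C : ℝ, ∀ {Ω : Type v} [MeasurableSpace Ω] (P : Measure Ω) [IsProbabilityMeasure P]
      (X : ℕ → Ω → A), (∀ k, Measurable (X k)) → iIndepFun X P → (∀ k, P.map (X k) = μ) →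
      ∀ n : ℕ, 1 ≤ n → ∀ x : ℝ,
        |P.real {ω | (√n)⁻¹ * ∑ k ∈ Finset.range n, (f (X k ω) - ∫ y, f y ∂μ) / √Var[f; μ] ≤ x}
          - cdf (gaussianReal 0 1) x| ≤ C * (n : ℝ) ^ (-(δ / 2)) := by
  set m := ∫ y, f y ∂μ with hm
  set σ := √Var[f; μ] with hσ
  have hσ2 : σ ^ 2 = Var[f; μ] := Real.sq_sqrt (variance_nonneg _ _)
  set z : A → ℝ := fun y => (f y - m) / σ with hz
  have hzm : Measurable z := (hf.sub_const m).div_const σ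
  have htop : ENNReal.ofReal (2 + δ) ≠ ⊤ := ENNReal.ofReal_ne_top
  have hreal : (ENNReal.ofReal (2 + δ)).toReal = 2 + δ := ENNReal.toReal_ofReal (by linarith)
  have hne0 : ENNReal.ofReal (2 + δ) ≠ 0 := by simp; linarith
  have h1le : (1 : ENNReal) ≤ ENNReal.ofReal (2 + δ) := by
    rw [← ENNReal.ofReal_one]
    exact ENNReal.ofReal_le_ofReal (by linarith)
  have hf1 : Integrable f μ := memLp_one_iff_integrable.mp (hfδ.mono_exponent h1le)
  have hzδ : MemLp z (ENNReal.ofReal (2 + δ)) μ := by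
    have := (hfδ.sub (memLp_const m)).mul_const σ⁻¹
    exact this
  have hz1 : ∫ y, z y ∂μ = 0 := by
    simp only [hz]
    rw [integral_div, integral_sub hf1 (integrable_const _)]
    simp [hm]
  have hz2 : ∫ y, z y ^ 2 ∂μ = 1 := by
    simp only [hz, div_pow]
    rw [integral_div, ← variance_eq_integral hf.aemeasurable, hσ2, div_self hvar]
  have hzi : Integrable (fun y => |z y| ^ (2 + δ)) μ := by
    have := (integrable_norm_rpow_iff hzm.aestronglyMeasurable hne0 htop).mpr hzδ
    rw [hreal] at this
    exact this
  have : IsProbabilityMeasure (μ.map z) := Measure.isProbabilityMeasure_map hzm.aemeasurable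
  -- Fixed from the law of `z` alone, before any sample space is introduced, so the constant is
  -- uniform over realisations.
  obtain ⟨C, hC⟩ := exists_abs_cdf_sub_cdf_gaussianReal_le hδ₀ hδ₁ (μ.map z)
    (by rw [integral_map hzm.aemeasurable (by fun_prop), hz1])
    (by rw [integral_map hzm.aemeasurable (by fun_prop), hz2])
    (by
      have hm : Measurable fun x : ℝ => |x| ^ (2 + δ) := measurable_id.abs.pow_const _
      rw [integrable_map_measure hm.aestronglyMeasurable hzm.aemeasurable]
      exact hzi)
  refine ⟨C, fun {Ω} _ P _ X hX hind hXμ n hn x => ?_⟩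
  set T : Ω → ℝ := fun ω => (√n)⁻¹ * ∑ k ∈ Finset.range n, z (X k ω)
  have hTm : Measurable T :=
    measurable_const.mul (Finset.measurable_fun_sum _ fun k _ => hzm.comp (hX k))
  have hzX : ∀ k, P.map (fun ω => z (X k ω)) = μ.map z := fun k => by
    rw [← hXμ k, Measure.map_map hzm (hX k)]
    rfl
  have hchar : ∀ t, charFun (P.map T) t = charFun (μ.map z) ((√n)⁻¹ * t) ^ n := by
    intro t
    have h := charFun_inv_sqrt_mul_sum (X := fun k ω => z (X k ω)) (P := P)
      (hind.comp (fun _ => z) fun _ => hzm) (fun i => ⟨(hzm.comp (hX i)).aemeasurable,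
        (hzm.comp (hX 0)).aemeasurable, by rw [hzX, hzX]⟩) (n := n) (t := t)
    rw [hzX] at h
    exact h
  have h := hC n hn (P.map T) (Measure.isProbabilityMeasure_map hTm.aemeasurable) hchar x
  have : IsProbabilityMeasure (P.map T) := Measure.isProbabilityMeasure_map hTm.aemeasurable
  rw [cdf_eq_real, map_measureReal_apply hTm measurableSet_Iic] at h
  exact h

/-! ### Nondegeneracy, the cut-off, the common law, and perturbation. -/

/-- With zero variance `log p` is almost everywhere constant, hence constant at every atom of
positive mass; injectivity of `log` then contradicts nonuniformity. -/
lemma variance_log_ne_zero {A : Type*} [MeasurableSpace A] [MeasurableSingletonClass A]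
    [Countable A] {p : A → ℝ} (hp : IsNonuniform p) (μ : Measure A) [IsProbabilityMeasure μ]
    (hμ : ∀ x, μ.real {x} = p x) (h2 : MemLp (fun x => Real.log (p x)) 2 μ) :
    Var[fun x => Real.log (p x); μ] ≠ 0 := by
  obtain ⟨x, y, hx, hy, hxy⟩ := hp
  intro h
  have hi : Integrable (fun w => (Real.log (p w) - ∫ x, Real.log (p x) ∂μ) ^ 2) μ :=
    (h2.sub (memLp_const _)).integrable_sq
  rw [variance_eq_integral (Measurable.of_discrete).aemeasurable,
    integral_eq_zero_iff_of_nonneg (fun _ => sq_nonneg _) hi] at h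
  have key : ∀ w, 0 < p w → Real.log (p w) = ∫ x, Real.log (p x) ∂μ := by
    intro w hw
    by_contra hne
    have h0 : μ {w} = 0 := by
      refine measure_mono_null ?_ (ae_iff.mp h)
      rintro _ rfl
      simpa [sub_eq_zero] using hne
    have := hμ w
    rw [measureReal_def, h0] at this
    simp only [ENNReal.toReal_zero] at this
    linarith
  exact hxy (Real.log_injOn_pos hx hy ((key x hx).trans (key y hy).symm))

/-- The letters enumerated strictly before the cut-off `K`. -/
noncomputable def headLetters {A : Type*} [DecidableEq A] (a : ℕ+ ≃ A) (K : ℤ) : Finset A :=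
  -- Indices start at `1`, so there are `K - 1` letters before `K`; truncation makes the head empty
  -- when `K ≤ 1`.
  (Finset.range (K.toNat - 1)).image fun j => a (Nat.succPNat j)

lemma apply_mem_headLetters_iff {A : Type*} [DecidableEq A] (a : ℕ+ ≃ A) (K : ℤ) (i : ℕ+) :
    a i ∈ headLetters a K ↔ ((i : ℕ) : ℤ) < K := by
  simp only [headLetters, Finset.mem_image, Finset.mem_range, EmbeddingLike.apply_eq_iff_eq]
  have hi := i.pos
  constructor
  · rintro ⟨j, hj, rfl⟩
    simp only [Nat.succPNat_coe]
    omega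
  · intro h
    refine ⟨i.natPred, ?_, by simp⟩
    have := PNat.natPred_add_one i
    omega

lemma card_headLetters_le {A : Type*} [DecidableEq A] (a : ℕ+ ≃ A) (K : ℤ) {b : ℝ} (hb : 0 ≤ b)
    (hK : (K : ℝ) ≤ b) : ((headLetters a K).card : ℝ) ≤ b := by
  have h1 : (headLetters a K).card ≤ K.toNat - 1 := Finset.card_image_le.trans (by simp)
  rcases le_or_gt K 0 with h | h
  · have : (headLetters a K).card = 0 := by omega
    rw [this]
    simpa using hb
  · have h2 : ((headLetters a K).card : ℤ) ≤ K := by omega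
    have h3 : ((headLetters a K).card : ℝ) ≤ K := by exact_mod_cast h2
    exact h3.trans hK

lemma integral_tail_neg_log {A : Type*} [MeasurableSpace A] [MeasurableSingletonClass A]
    [Countable A] [DecidableEq A] (a : ℕ+ ≃ A) (p : A → ℝ) (μ : Measure A)
    (hμ : ∀ x, μ.real {x} = p x) (hlog : Integrable (fun x => Real.log (p x)) μ) (K : ℤ) :
    ∫ x, (if x ∈ headLetters a K then 0 else -Real.log (p x)) ∂μ =
      -∑' i : {i : ℕ+ // K ≤ ((i : ℕ) : ℤ)}, p (a i) * Real.log (p (a i)) := by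
  rw [integral_countable, ← a.tsum_eq]
  · have h : ∑' i : {i : ℕ+ // K ≤ ((i : ℕ) : ℤ)}, p (a i) * Real.log (p (a i)) = _ :=
      tsum_subtype {i : ℕ+ | K ≤ ((i : ℕ) : ℤ)} fun i => p (a i) * Real.log (p (a i))
    rw [h, ← tsum_neg]
    refine tsum_congr fun i => ?_
    rw [hμ]
    by_cases hi : ((i : ℕ) : ℤ) < K
    · rw [if_pos ((apply_mem_headLetters_iff a K i).mpr hi),
        Set.indicator_of_notMem (by simpa using hi)]
      simp
    · rw [if_neg (mt (apply_mem_headLetters_iff a K i).mp hi),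
        Set.indicator_of_mem (by simpa using hi)]
      simp
  · refine hlog.mono (Measurable.of_discrete).aestronglyMeasurable (.of_forall fun x => ?_)
    split_ifs <;> simp

lemma map_eq_of_measureReal_eq {A Ω : Type*} [MeasurableSpace A] [MeasurableSingletonClass A]
    [Countable A] [MeasurableSpace Ω] {p : A → ℝ} (μ : Measure A) [IsProbabilityMeasure μ]
    (hμ : ∀ x, μ.real {x} = p x) (P : Measure Ω) [IsProbabilityMeasure P] {X : Ω → A}
    (hX : Measurable X) (hXp : ∀ x, P.real {ω | X ω = x} = p x) : P.map X = μ := by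
  refine Measure.ext_of_singleton fun x => ?_
  have : IsProbabilityMeasure (P.map X) := Measure.isProbabilityMeasure_map hX.aemeasurable
  rw [← measureReal_eq_measureReal_iff, map_measureReal_apply hX (measurableSet_singleton x), hμ,
    ← hXp]
  rfl

lemma ae_forall_pos {A Ω : Type*} [Countable A] [MeasurableSpace Ω] {p : A → ℝ}
    (hp_nonneg : ∀ x, 0 ≤ p x) (P : Measure Ω) [IsProbabilityMeasure P] {X : ℕ → Ω → A}
    (hXp : ∀ k x, P.real {ω | X k ω = x} = p x) : ∀ᵐ ω ∂P, ∀ k, 0 < p (X k ω) := by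
  refine ae_all_iff.mpr fun k => ?_
  have h : ∀ᵐ ω ∂P, ∀ x, p x = 0 → X k ω ≠ x := by
    refine ae_all_iff.mpr fun x => ?_
    by_cases hx : p x = 0
    · have h0 := hXp k x
      rw [hx, measureReal_eq_zero_iff] at h0
      have : ∀ᵐ ω ∂P, X k ω ≠ x := by
        rw [ae_iff]
        simpa using h0
      filter_upwards [this] with ω hω _ using hω
    · exact .of_forall fun ω h => absurd h hx
  filter_upwards [h] with ω hω
  exact lt_of_le_of_ne (hp_nonneg _) fun h0 => hω _ h0.symm rfl

/-- A nonnegative perturbation that is small with high probability does not spoil a normal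
approximation. -/
lemma abs_measureReal_lt_sub_cdf_le {Ω : Type*} [MeasurableSpace Ω] (P : Measure Ω)
    [IsProbabilityMeasure P] {T R W : Ω → ℝ} (hW : ∀ ω, W ω = T ω - R ω)
    (hR : ∀ᵐ ω ∂P, 0 ≤ R ω) {ε b c : ℝ} (hε : 0 < ε)
    (hT : ∀ x, |P.real {ω | T ω ≤ x} - cdf (gaussianReal 0 1) x| ≤ b)
    (hRε : P.real {ω | ε ≤ R ω} ≤ c) (x : ℝ) :
    |P.real {ω | W ω < x} - cdf (gaussianReal 0 1) x| ≤ b + c + ε := by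
  have hc : 0 ≤ c := measureReal_nonneg.trans hRε
  rw [abs_le]
  constructor
  -- Here `R ≥ 0` suffices; the shift by `ε` only turns `≤` into `<`. The size of `R` enters in the
  -- other direction.
  · have h1 : P.real {ω | T ω ≤ x - ε} ≤ P.real {ω | W ω < x} := by
      refine ENNReal.toReal_mono (measure_ne_top _ _) (measure_mono_ae ?_)
      filter_upwards [hR] with ω hω (h : T ω ≤ x - ε)
      change W ω < x
      rw [hW]
      linarith
    have h2 := (abs_le.mp (hT (x - ε))).1
    have h3 := cdf_gaussianReal_sub_le (show x - ε ≤ x by linarith)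
    linarith
  · have h1 : P.real {ω | W ω < x} ≤ P.real {ω | T ω ≤ x + ε} + P.real {ω | ε ≤ R ω} := by
      refine (measureReal_mono (fun ω (h : W ω < x) => ?_)).trans (measureReal_union_le _ _)
      rw [hW] at h
      by_cases hr : ε ≤ R ω
      · exact Or.inr hr
      · left
        change T ω ≤ x + ε
        linarith
    have h2 := (abs_le.mp (hT (x + ε))).2
    have h3 := cdf_gaussianReal_sub_le (show x ≤ x + ε by linarith)
    linarith

end DiversityIndex

/-! ### Assembly of the estimate. -/

theorem theorem3p1 {A : Type*} [MeasurableSpace A] [MeasurableSingletonClass A]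
    (a : ℕ+ ≃ A) (δ : ℝ) (hδ₀ : 0 < δ) (hδ₁ : δ < 1 / 2)
    (p : A → ℝ) (hp_nonneg : ∀ x, 0 ≤ p x) (hp_sum : HasSum p 1)
    (hp : DiversityIndex.IsNonuniform p) (C₀ : ℝ) :
    ∃ C : ℝ, ∀ K : ℕ → ℤ, DiversityIndex.IsTailCutoff a p δ C₀ K →
      ∀ {Ω : Type*} [MeasurableSpace Ω] (P : Measure Ω) [IsProbabilityMeasure P]
        (X : ℕ → Ω → A),
        (∀ k, Measurable (X k)) → iIndepFun X P →
        (∀ k x, P.real {ω | X k ω = x} = p x) →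
        Integrable (fun ω => |Real.log (p (X 0 ω))| ^ (2 + δ)) P →
        ∀ n : ℕ, 1 ≤ n → ∀ x : ℝ,
          |P.real {ω | Real.sqrt n *
                (DiversityIndex.plugInEntropy X n ω - DiversityIndex.shannonEntropy p) /
                Real.sqrt (variance (fun ω' => Real.log (p (X 0 ω'))) P) < x}
              - cdf (gaussianReal 0 1) x| ≤ C * (n : ℝ) ^ (-(δ / 2)) := by
  classical
  open DiversityIndex in
  have hA : Countable A := a.countable_iff.mp inferInstance
  -- The constant must precede the probability space, so the law is obtained from `p` alone. If no
  -- such law exists, no sample meets the hypotheses and any constant works.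
  by_cases hex : ∃ μ : Measure A, IsProbabilityMeasure μ ∧ (∀ x, μ.real {x} = p x) ∧
      Integrable (fun x => |Real.log (p x)| ^ (2 + δ)) μ
  swap
  · refine ⟨0, fun K hK Ω _ P _ X hX hind hXp hint => absurd ?_ hex⟩
    refine ⟨P.map (X 0), Measure.isProbabilityMeasure_map (hX 0).aemeasurable, fun x => ?_, ?_⟩
    · rw [map_measureReal_apply (hX 0) (measurableSet_singleton x), ← hXp 0 x]
      rfl
    · rw [integrable_map_measure (Measurable.of_discrete).aestronglyMeasurable
        (hX 0).aemeasurable]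
      exact hint
  obtain ⟨μ, hμprob, hμ, hμint⟩ := hex
  set f : A → ℝ := fun x => -Real.log (p x) with hf
  have hreal : (ENNReal.ofReal (2 + δ)).toReal = 2 + δ := ENNReal.toReal_ofReal (by linarith)
  have hlogδ : MemLp (fun x => Real.log (p x)) (ENNReal.ofReal (2 + δ)) μ := by
    refine (integrable_norm_rpow_iff (Measurable.of_discrete).aestronglyMeasurable
      (by simp; linarith) ENNReal.ofReal_ne_top).mp ?_
    rw [hreal]
    exact hμint
  have hlog2 : MemLp (fun x => Real.log (p x)) 2 μ := by
    refine hlogδ.mono_exponent ?_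
    rw [show (2 : ENNReal) = ENNReal.ofReal 2 by simp]
    exact ENNReal.ofReal_le_ofReal (by linarith)
  have hlog1 : Integrable (fun x => Real.log (p x)) μ := hlog2.integrable (by norm_num)
  have hvareq : Var[f; μ] = Var[fun x => Real.log (p x); μ] := variance_fun_neg
  have hvar : Var[f; μ] ≠ 0 := hvareq ▸ variance_log_ne_zero hp μ hμ hlog2
  set σ := √Var[f; μ] with hσ
  have hσ0 : 0 < σ := Real.sqrt_pos.mpr (lt_of_le_of_ne (variance_nonneg _ _) hvar.symm)
  have hH : ∫ x, f x ∂μ = shannonEntropy p := by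
    simp only [hf]
    rw [integral_neg, integral_countable hlog1, shannonEntropy]
    simp_rw [hμ, smul_eq_mul]
  obtain ⟨C, hC⟩ := exists_abs_measureReal_sum_le_sub_cdf_le (f := f) hδ₀ hδ₁.le μ
    (Measurable.of_discrete) hlogδ.neg hvar
  -- The summands come from Berry–Esseen, the Markov bound on `R`, and the shift by `ε`.
  refine ⟨C + (1 + C₀) / σ + 1, fun K hK Ω _ P _ X hX hind hXp _ n hn x => ?_⟩
  have hn0 : (0 : ℝ) < n := by exact_mod_cast hn
  have hsn : 0 < √(n : ℝ) := Real.sqrt_pos.mpr hn0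
  have hXμ : ∀ k, P.map (X k) = μ := fun k => map_eq_of_measureReal_eq μ hμ P (hX k) (hXp k)
  have hpos := ae_forall_pos hp_nonneg P hXp
  have hvX : Var[fun ω' => Real.log (p (X 0 ω')); P] = Var[f; μ] := by
    rw [hvareq, ← hXμ 0, variance_map (Measurable.of_discrete).aemeasurable (hX 0).aemeasurable]
    rfl
  rw [hvX]
  set ε := (n : ℝ) ^ (-(δ / 2)) with hε
  have hε0 : 0 < ε := by positivity
  set D : Ω → ℝ := fun ω =>
    (1 / (n : ℝ)) * ∑ k ∈ Finset.range n, -Real.log (p (X k ω)) - plugInEntropy X n ω with hD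
  have hsq : √(n : ℝ) * √n = n := Real.mul_self_sqrt hn0.le
  have hW : ∀ ω, √n * (plugInEntropy X n ω - shannonEntropy p) / σ =
      (√n)⁻¹ * ∑ k ∈ Finset.range n, (f (X k ω) - ∫ y, f y ∂μ) / σ - √n * D ω / σ := by
    intro ω
    rw [← Finset.sum_div, Finset.sum_sub_distrib, hH]
    simp only [Finset.sum_const, Finset.card_range, nsmul_eq_mul, hD, hf]
    have e1 : 1 / (n : ℝ) = (√n)⁻¹ * (√n)⁻¹ := by rw [← mul_inv, hsq, one_div]
    have e2 : (n : ℝ) * shannonEntropy p = √n * √n * shannonEntropy p := by rw [hsq]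
    rw [e1, e2]
    have hy := hsn.ne'
    generalize √(n : ℝ) = y at hy
    field_simp
    ring
  have hR : ∀ᵐ ω ∂P, 0 ≤ √n * D ω / σ := by
    filter_upwards [hpos] with ω hω
    have := plugInEntropy_le_mean hp_nonneg hp_sum X hn ω hω
    positivity
  have hRε : P.real {ω | ε ≤ √n * D ω / σ} ≤ (1 + C₀) / σ * ε := by
    have hset : {ω | ε ≤ √n * D ω / σ} = {ω | ε * σ / √n ≤ D ω} := by
      ext ω
      change ε ≤ √n * D ω / σ ↔ ε * σ / √n ≤ D ω
      rw [le_div_iff₀ hσ0, div_le_iff₀ hsn, mul_comm (D ω)]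
    rw [hset]
    have h := mul_measureReal_le_of_mean_sub_plugInEntropy hp_nonneg hp_sum hX hind hXp μ hXμ
      hpos hlog1 hn (headLetters a (K n)) (ε * σ / √n)
    rw [integral_tail_neg_log a p μ hμ hlog1] at h
    set s := (n : ℝ) ^ (1 / 2 + δ) with hs
    have hs0 : 0 < s := by positivity
    have hcard := card_headLetters_le a (K n) (by positivity) (hK.le_rpow n hn)
    have hhead : ((headLetters a (K n)).card : ℝ) / n ≤ s⁻¹ := by
      rw [div_le_iff₀ hn0]
      refine hcard.trans (le_of_eq ?_)
      rw [hs, ← Real.rpow_neg hn0.le]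
      nth_rewrite 3 [← Real.rpow_one (n : ℝ)]
      rw [← Real.rpow_add hn0]
      ring_nf
    have htail : -∑' i : {i : ℕ+ // K n ≤ ((i : ℕ) : ℤ)}, p (a i) * Real.log (p (a i)) ≤
        C₀ * s⁻¹ := by
      rw [← div_eq_mul_inv, le_div_iff₀ hs0]
      have := hK.tail_entropy n hn
      linarith
    -- The scaled mean of `D` is of order `n ^ (-δ) = ε ^ 2`; Markov at threshold `ε` spends one
    -- factor and leaves the other as the rate.
    have hεs : √n * s⁻¹ = ε * ε := by
      rw [hε, hs, ← Real.rpow_neg hn0.le, Real.sqrt_eq_rpow, ← Real.rpow_add hn0,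
        ← Real.rpow_add hn0]
      ring_nf
    have h2 : ε * σ / √n * P.real {ω | ε * σ / √n ≤ D ω} ≤ (1 + C₀) * s⁻¹ := by
      refine h.trans ?_
      linarith
    have hq : 0 < ε * σ / √n := by positivity
    rw [← le_div_iff₀' hq] at h2
    refine h2.trans (le_of_eq ?_)
    calc (1 + C₀) * s⁻¹ / (ε * σ / √n) = (1 + C₀) * (√n * s⁻¹) / (ε * σ) := by field_simp
      _ = (1 + C₀) / σ * ε := by rw [hεs]; field_simp
  have := abs_measureReal_lt_sub_cdf_le P hW hR hε0 (fun x => hC P X hX hind hXμ n hn x) hRε x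
  refine this.trans (le_of_eq ?_)
  ring
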